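/- Conventions. Fix a notion of small set. A bicategory is \emph{locally essentially small} if each of its hom-categories is equivalent to a small category. A 1-arrow $q\colon u\to x$ of a 2-category $K$ is \emph{ff} if for every object $z$ the functor $q_*\colon K(z,u)\to K(z,x)$ is fully faithful. A \emph{2-site} $(K,J)$ is a 2-category $K$ with a class $J$ of 1-arrows such that (i) $J$ contains the identity arrows and is closed under composition; (ii) for all $q\colon u\to x$ in $J$ and all $f\colon y\to x$ there are $k\colon v\to y$ in $J$, $g\colon v\to u$ and an invertible 2-arrow $q\circ g\simeq f\circ k$; (iii) every arrow in $J$ is ff. A 1-arrow $f\colon x\to y$ is a \emph{weak equivalence} if it is ff and there are $j\colon u\to y$ in $J$ and $s\colon u\to x$ with $f\circ s\simeq j$; the class of weak equivalences is denoted $W_J$. A subclass $V\subset J$ is a \emph{locally small cofinal} class in $J$ if for every $f\colon x\to y$ in $J$ there are $g\colon z\to y$ in $V$ and $s\colon z\to x$ with $f\circ s\simeq g$, and for every object $y$ the arrows in $V$ with codomain $y$ form a small set. A 2-functor (pseudofunctor) $Q\colon K\to L$ to a bicategory $L$ is a \emph{localisation of $K$ at $W_J$} if it sends the arrows in $W_J$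 to equivalences and, for every bicategory $A$, precomposition with $Q$ is an equivalence of bicategories from $\mathbf{Bicat}(L,A)$ (pseudofunctors, pseudonatural transformations, modifications) to the full sub-bicategory of $\mathbf{Bicat}(K,A)$ on the pseudofunctors that send the arrows in $W_J$ to equivalences; one then writes $K[W_J^{-1}]$ for $L$, which is determined up to equivalence. Corollary. Let $(K,J)$ be a 2-site such that $K$ is locally essentially small and $J$ has a locally small cofinal class. Then the localisation $K[W_J^{-1}]$ exists and is locally essentially small; that is, there is a localisation $K\to L$ of $K$ at $W_J$ with $L$ locally essentially small, and for every localisation $K\to L$ of $K$ at $W_J$ the bicategory $L$ is locally essentially small. -/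

import Mathlib

open CategoryTheory Bicategory
open scoped CategoryTheory.Pseudofunctor.StrongTrans

namespace TwoSite

section Basic

variable {K : Type*} [Bicategory K]

/-- A 1-arrow `q : u ⟶ x` is *ff* (representably fully faithful) if, for every object `z`,
postcomposition `q_* : K(z, u) ⥤ K(z, x)` is a fully faithful functor. -/
def IsFF {u x : K} (q : u ⟶ x) : Prop :=
  ∀ z : K, (postcomp z q).Full ∧ (postcomp z q).Faithful

/-- A 1-arrow is an (internal) equivalence if it has a pseudo-inverse. -/
def IsEquiv {a b : K} (f : a ⟶ b) : Prop :=
  ∃ g : b ⟶ a, Nonempty (f ≫ g ≅ 𝟙 a) ∧ Nonempty (g ≫ f ≅ 𝟙 b)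

/-- A *fully faithful singleton coverage*: a class `J` of ff 1-arrows that contains the
identities, is closed under composition, and is such that each `q ∈ J` and each 1-arrow `f` with
the same codomain fit into a square that commutes up to an invertible 2-arrow and whose side
opposite to `q` is in `J`. A 2-category together with such a class is a *2-site*. -/
structure IsFFSingletonCoverage (J : MorphismProperty K) : Prop where
  id_mem (x : K) : J (𝟙 x)
  comp_mem {x y z : K} (f : x ⟶ y) (g : y ⟶ z) : J f → J g → J (f ≫ g)
  exists_square {u x y : K} (q : u ⟶ x) (f : y ⟶ x) : J q →
    ∃ (v : K) (k : v ⟶ y) (g : v ⟶ u), J k ∧ Nonempty (g ≫ q ≅ k ≫ f)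
  ff {u x : K} (q : u ⟶ x) : J q → IsFF q

/-- A 1-arrow `f : x ⟶ y` is *`J`-locally split* if some `j : u ⟶ y` in `J` factors through `f`
up to an invertible 2-arrow. -/
def IsLocallySplit (J : MorphismProperty K) {x y : K} (f : x ⟶ y) : Prop :=
  ∃ (u : K) (j : u ⟶ y) (s : u ⟶ x), J j ∧ Nonempty (s ≫ f ≅ j)

/-- The class `W_J` of *weak equivalences*: the ff 1-arrows that are `J`-locally split. -/
def weakEquivalences (J : MorphismProperty K) : MorphismProperty K :=
  fun _ _ f => IsFF f ∧ IsLocallySplit J f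

/-- The subclass `V` is *cofinal* in `A`: for each `f : x ⟶ y` in `A` there are `g : z ⟶ y` in `V`
and `s : z ⟶ x` such that the composite of `s` and `f` is isomorphic to `g`. -/
def IsCofinal (V A : MorphismProperty K) : Prop :=
  V ≤ A ∧ ∀ ⦃x y : K⦄ (f : x ⟶ y), A f →
    ∃ (z : K) (g : z ⟶ y) (s : z ⟶ x), V g ∧ Nonempty (s ≫ f ≅ g)

end Basic

/-- The class `V` is *locally small*: for each object `y` the arrows of `V` with codomain `y` form
a set, i.e. are in bijection with a type in the universe `s` of small types. -/
def IsLocallySmallClass.{s, w, v, u} {K : Type u} [Bicategory.{w, v} K]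
    (V : MorphismProperty K) : Prop :=
  ∀ y : K, Small.{s} {f : Σ z : K, (z ⟶ y) // V f.2}

/-- A bicategory is *locally essentially small* if each of its hom-categories is equivalent to a
small category; `s` is the universe of small types. -/
def IsLocallyEssentiallySmall.{s, w, v, u} (K : Type u) [Bicategory.{w, v} K] : Prop :=
  ∀ x y : K, EssentiallySmall.{s} (x ⟶ y)

section Precomposition

universe w₁ v₁ u₁ w₂ v₂ u₂ w₃ v₃ u₃

variable {B : Type u₁} [Bicategory.{w₁, v₁} B] {C : Type u₂} [Bicategory.{w₂, v₂} C]

/-- The strong transformation `G ∘ Q ⟶ H ∘ Q` obtained from `θ : G ⟶ H` by precomposition. -/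
def precompTrans (Q : B ⥤ᵖ C) {A : Type u₃} [Bicategory.{w₃, v₃} A] {G H : C ⥤ᵖ A} (θ : G ⟶ H) :
    Q.comp G ⟶ Q.comp H where
  app a := θ.app (Q.obj a)
  naturality f := θ.naturality (Q.map f)
  naturality_naturality η := θ.naturality_naturality (Q.map₂ η)
  naturality_id a := by
    change _ ≫ _ ◁ (H.map₂ (Q.mapId a).hom ≫ (H.mapId (Q.obj a)).hom) =
      (G.map₂ (Q.mapId a).hom ≫ (G.mapId (Q.obj a)).hom) ▷ _ ≫ _
    rw [whiskerLeft_comp, comp_whiskerRight, ← θ.naturality_naturality_assoc, θ.naturality_id]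
    exact (Category.assoc _ _ _).symm
  naturality_comp {a b c} f g := by
    change _ ≫ _ ◁ (H.map₂ (Q.mapComp f g).hom ≫ (H.mapComp (Q.map f) (Q.map g)).hom) =
      (G.map₂ (Q.mapComp f g).hom ≫ (G.mapComp (Q.map f) (Q.map g)).hom) ▷ _ ≫ _
    rw [whiskerLeft_comp, comp_whiskerRight, ← θ.naturality_naturality_assoc, θ.naturality_comp]
    exact (Category.assoc _ _ _).symm

theorem whisker_id_comm {A : Type u₃} [Bicategory.{w₃, v₃} A] {a b c d : A} {f : a ⟶ b}
    {g : b ⟶ c} {h : a ⟶ d} {k : d ⟶ c} (η : f ≫ g ⟶ h ≫ k) :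
    f ◁ 𝟙 g ≫ η = η ≫ 𝟙 h ▷ k := by
  simp

/-- The 2-functor `Q^* : Bicat(C, A) → Bicat(B, A)` given by precomposition with `Q`. Here
`Bicat(C, A)` is the bicategory of pseudofunctors, strong transformations and modifications. -/
def precomposition (Q : B ⥤ᵖ C) (A : Type u₃) [Bicategory.{w₃, v₃} A] :
    (C ⥤ᵖ A) ⥤ᵖ (B ⥤ᵖ A) where
  obj G := Q.comp G
  map θ := precompTrans Q θ
  map₂ Γ := ⟨{ app := fun a => Γ.as.app (Q.obj a)
               naturality := fun f => Γ.as.naturality (Q.map f) }⟩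
  mapId G := Pseudofunctor.StrongTrans.isoMk (fun a => Iso.refl (𝟙 (G.obj (Q.obj a)))) (fun f => whisker_id_comm _)
  mapComp θ ι := Pseudofunctor.StrongTrans.isoMk
    (fun a => Iso.refl (θ.app (Q.obj a) ≫ ι.app (Q.obj a))) (fun f => whisker_id_comm _)
  map₂_id _ := rfl
  map₂_comp _ _ := rfl
  map₂_whisker_left θ _ _ Γ := by
    ext a
    change _ = 𝟙 _ ≫ (θ.app (Q.obj a) ◁ Γ.as.app (Q.obj a)) ≫ 𝟙 _
    rw [Category.id_comp, Category.comp_id]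
    rfl
  map₂_whisker_right Γ ι := by
    ext a
    change _ = 𝟙 _ ≫ (Γ.as.app (Q.obj a) ▷ ι.app (Q.obj a)) ≫ 𝟙 _
    rw [Category.id_comp, Category.comp_id]
    rfl
  map₂_associator θ ι κ := by
    ext a
    change (α_ (θ.app (Q.obj a)) (ι.app (Q.obj a)) (κ.app (Q.obj a))).hom =
      𝟙 _ ≫ 𝟙 _ ▷ _ ≫ (α_ _ _ _).hom ≫ _ ◁ 𝟙 _ ≫ 𝟙 _
    simp
  map₂_left_unitor θ := by
    ext a
    change (λ_ (θ.app (Q.obj a))).hom = 𝟙 _ ≫ 𝟙 _ ▷ _ ≫ (λ_ _).hom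
    simp
  map₂_right_unitor θ := by
    ext a
    change (ρ_ (θ.app (Q.obj a))).hom = 𝟙 _ ≫ _ ◁ 𝟙 _ ≫ (ρ_ _).hom
    simp

/-- The pseudofunctor `F` sends the 1-arrows in `W` to equivalences. -/
def Inverts (F : B ⥤ᵖ C) (W : MorphismProperty B) : Prop :=
  ∀ ⦃a b : B⦄ (f : a ⟶ b), W f → IsEquiv (F.map f)

end Precomposition

/-- The 2-functor `Q : B → C` is a *localisation* of the bicategory `B` at the class `W` of
1-arrows, tested against the bicategories `A` in the universes `wA vA uA`: it sends the 1-arrows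
in `W` to equivalences and, for every `A`, precomposition with `Q` is an equivalence of
bicategories from `Bicat(C, A)` to the full sub-bicategory `Bicat_W(B, A)` of `Bicat(B, A)` on the
2-functors that send the arrows in `W` to equivalences. That is, precomposition is essentially
surjective (up to equivalence) onto the objects of `Bicat_W(B, A)`, and it is an equivalence on
every hom-category; it takes values in `Bicat_W(B, A)` because of `inverts`. -/
structure IsLocalisation.{wA, vA, uA, w₁, v₁, u₁, w₂, v₂, u₂}
    {B : Type u₁} [Bicategory.{w₁, v₁} B] {C : Type u₂} [Bicategory.{w₂, v₂} C]
    (Q : B ⥤ᵖ C) (W : MorphismProperty B) : Prop where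
  inverts : Inverts Q W
  essSurj (A : Type uA) [Bicategory.{wA, vA} A] (F : B ⥤ᵖ A) : Inverts F W →
    ∃ G : C ⥤ᵖ A, Nonempty ((precomposition Q A).obj G ≌ F)
  locally_equivalence (A : Type uA) [Bicategory.{wA, vA} A] (G H : C ⥤ᵖ A) :
    ((precomposition Q A).mapFunctor G H).IsEquivalence

end TwoSite

universe s w v u w' v' u' wA vA uA

/-!
The localisation is constructed from generators and relations. `FormalLoc J` is the free bicategory
on `K` together with an adjoint inverse of each arrow in `J`: its 1-arrows are formal composites of
arrows of `K` and formal inverses, its 2-arrows are formal composites modulo the axioms of a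
bicategory, of the 2-functor `incl J` and of adjoint equivalences. Its universal property
(`FormalLoc.isLocalisation_incl`) holds for every class of arrows and in all universes: a 2-functor
that inverts `J` extends along `incl J` on the nose, and a transformation or a modification given on
`K` extends because its value at a formal inverse is forced by the counit. As the members of `J` are
ff, a 2-functor inverts `J` if and only if it inverts the weak equivalences, by a two-out-of-six
argument (`Inverts.weakEquivalences`).

Smallness rests on calculus of fractions. A *chart* of a 1-arrow `T : x ⟶ y` of `FormalLoc J` is an
arrow `j : u ⟶ x` in `J` and an arrow `b : u ⟶ y` of `K` with `j ≫ T ≅ b`. Charts can be pulled back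
along arrows of `K`, by the squares of the 2-site, and pushed along formal inverses of arrows in
`J`, by composing `j` with the arrow; hence every 1-arrow has a chart. The main point is that every
2-arrow is, after restriction along some arrow in `J`, represented by a 2-arrow of `K` between the
representing arrows of the charts (`FormalLoc.isLocallyRepresentable_chart`). This is proved by
induction on the 2-arrow: whiskering on the left acts on charts, and for each generating 2-arrow
`η : S ⟶ S'` the 2-arrow `η ▷ T` relates the charts of `S ≫ T` and of `S' ≫ T` built from a chart of
`T`. No relation between 2-arrows has to be compared with `K`, since only the existence of
representatives matters. By cofinality the arrows in `J` may be taken in the locally small class, so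
that the isomorphism classes of 1-arrows and the 2-arrows between two of them inject into small
types (`FormalLoc.isLocallyEssentiallySmall`): restriction along an arrow in `J` is faithful and
conservative on isomorphism classes, because `incl J` inverts it.

An arbitrary localisation `Q : K ⥤ᵖ L` is only tested against bicategories in certain universes, so
that `L` and `FormalLoc J` are replaced by copies `Up L` and `Up (FormalLoc J)` that live there. The
universal properties give `P : L ⥤ᵖ FormalLoc J` and `F : FormalLoc J ⥤ᵖ Up L` whose composite is
equivalent to the 2-functor `L ⥤ᵖ Up L`, and therefore `P` is faithful on 2-arrows and reflects
isomorphisms between 1-arrows (`IsLocalisation.isLocallyEssentiallySmall`).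
-/


namespace TwoSite

/-! ### Adjoint pseudo-inverses -/

section Equivalences

variable {B : Type*} [Bicategory B]

/-- A pseudo-inverse of the 1-arrow `f` together with the data of an adjoint equivalence. -/
structure AdjointInverse {a b : B} (f : a ⟶ b) where
  /-- The pseudo-inverse. -/
  inv : b ⟶ a
  /-- The unit of the adjoint equivalence. -/
  unit : 𝟙 a ≅ f ≫ inv
  /-- The counit of the adjoint equivalence. -/
  counit : inv ≫ f ≅ 𝟙 b
  triangle : unit.hom ▷ f ≫ (α_ f inv f).hom ≫ f ◁ counit.hom = (λ_ f).hom ≫ (ρ_ f).inv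

theorem IsEquiv.nonempty_adjointInverse {a b : B} {f : a ⟶ b} (hf : IsEquiv f) :
    Nonempty (AdjointInverse f) := by
  obtain ⟨g, ⟨η⟩, ⟨ζ⟩⟩ := hf
  refine ⟨⟨g, η.symm, adjointifyCounit η.symm ζ, ?_⟩⟩
  have := congrArg Iso.hom (adjointifyCounit_left_triangle η.symm ζ)
  simpa [leftZigzagIso, leftZigzag, bicategoricalComp] using this

theorem AdjointInverse.isEquiv {a b : B} {f : a ⟶ b} (e : AdjointInverse f) : IsEquiv f :=
  ⟨e.inv, ⟨e.unit.symm⟩, ⟨e.counit⟩⟩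

end Equivalences

/-! ### The formal localisation -/

/-- The formal localisation of the bicategory `K` at the class `W` of 1-arrows. It has the objects
of `K`; its 1-arrows are formal composites of arrows of `K` and of formal inverses of arrows in
`W`, and its 2-arrows are equivalence classes of formal composites. It is wrapped in a structure to
keep its bicategory structure apart from that of `K`. -/
structure FormalLoc {K : Type u} [Bicategory.{w, v} K] (W : MorphismProperty K) : Type u where
  /-- The underlying object. -/
  as : K

namespace FormalLoc

variable {K : Type u} [Bicategory.{w, v} K]

/-- The 1-arrows of the formal localisation: formal composites, not taken up to associativity, so
that a 2-functor extends to them by recursion. -/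
inductive Word (W : MorphismProperty K) : K → K → Type (max u v)
  | of {a b : K} (f : a ⟶ b) : Word W a b
  | inv {a b : K} (f : a ⟶ b) (hf : W f) : Word W b a
  | id (a : K) : Word W a a
  | comp {a b c : K} (f : Word W a b) (g : Word W b c) : Word W a c

/-- Representatives of the 2-arrows of the formal localisation. -/
inductive Cell (W : MorphismProperty K) : ∀ {a b : K}, Word W a b → Word W a b → Type (max u v w)
  | id {a b : K} (f : Word W a b) : Cell W f f
  | vcomp {a b : K} {f g h : Word W a b} (η : Cell W f g) (θ : Cell W g h) : Cell W f h
  | whiskerLeft {a b c : K} (f : Word W a b) {g h : Word W b c} (η : Cell W g h) :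
      Cell W (f.comp g) (f.comp h)
  | whiskerRight {a b c : K} {f g : Word W a b} (h : Word W b c) (η : Cell W f g) :
      Cell W (f.comp h) (g.comp h)
  | assoc {a b c d : K} (f : Word W a b) (g : Word W b c) (h : Word W c d) :
      Cell W ((f.comp g).comp h) (f.comp (g.comp h))
  | assocInv {a b c d : K} (f : Word W a b) (g : Word W b c) (h : Word W c d) :
      Cell W (f.comp (g.comp h)) ((f.comp g).comp h)
  | leftUnitor {a b : K} (f : Word W a b) : Cell W ((Word.id a).comp f) f
  | leftUnitorInv {a b : K} (f : Word W a b) : Cell W f ((Word.id a).comp f)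
  | rightUnitor {a b : K} (f : Word W a b) : Cell W (f.comp (Word.id b)) f
  | rightUnitorInv {a b : K} (f : Word W a b) : Cell W f (f.comp (Word.id b))
  | of {a b : K} {f g : a ⟶ b} (η : f ⟶ g) : Cell W (.of f) (.of g)
  | mapId (a : K) : Cell W (.of (𝟙 a)) (.id a)
  | mapIdInv (a : K) : Cell W (.id a) (.of (𝟙 a))
  | mapComp {a b c : K} (f : a ⟶ b) (g : b ⟶ c) :
      Cell W (.of (f ≫ g)) (.comp (.of f) (.of g))
  | mapCompInv {a b c : K} (f : a ⟶ b) (g : b ⟶ c) :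
      Cell W (.comp (.of f) (.of g)) (.of (f ≫ g))
  | unit {a b : K} (f : a ⟶ b) (hf : W f) : Cell W (.id a) (.comp (.of f) (.inv f hf))
  | unitInv {a b : K} (f : a ⟶ b) (hf : W f) : Cell W (.comp (.of f) (.inv f hf)) (.id a)
  | counit {a b : K} (f : a ⟶ b) (hf : W f) : Cell W (.comp (.inv f hf) (.of f)) (.id b)
  | counitInv {a b : K} (f : a ⟶ b) (hf : W f) : Cell W (.id b) (.comp (.inv f hf) (.of f))

section

local infixr:80 " ⊚ " => Cell.vcomp
local infixr:81 " ◃ " => Cell.whiskerLeft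
local notation:81 η " ▹ " h => Cell.whiskerRight h η

/-- The relations between 2-arrows of the formal localisation: the axioms of a bicategory, the
axioms of a pseudofunctor for the inclusion of `K`, and those of an adjoint equivalence for each
arrow in `W`. -/
inductive Rel (W : MorphismProperty K) :
    ∀ {a b : K} {f g : Word W a b}, Cell W f g → Cell W f g → Prop
  | vcomp_right {a b : K} {f g h : Word W a b} (η : Cell W f g) (θ₁ θ₂ : Cell W g h) :
      Rel W θ₁ θ₂ → Rel W (η ⊚ θ₁) (η ⊚ θ₂)
  | vcomp_left {a b : K} {f g h : Word W a b} (η₁ η₂ : Cell W f g) (θ : Cell W g h) :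
      Rel W η₁ η₂ → Rel W (η₁ ⊚ θ) (η₂ ⊚ θ)
  | id_comp {a b : K} {f g : Word W a b} (η : Cell W f g) : Rel W (.id f ⊚ η) η
  | comp_id {a b : K} {f g : Word W a b} (η : Cell W f g) : Rel W (η ⊚ .id g) η
  | assoc {a b : K} {f g h i : Word W a b} (η : Cell W f g) (θ : Cell W g h) (ι : Cell W h i) :
      Rel W ((η ⊚ θ) ⊚ ι) (η ⊚ θ ⊚ ι)
  | whiskerLeft {a b c : K} (f : Word W a b) (g h : Word W b c) (η η' : Cell W g h) :
      Rel W η η' → Rel W (f ◃ η) (f ◃ η')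
  | whiskerLeft_id {a b c : K} (f : Word W a b) (g : Word W b c) :
      Rel W (f ◃ .id g) (.id (f.comp g))
  | whiskerLeft_comp {a b c : K} (f : Word W a b) {g h i : Word W b c} (η : Cell W g h)
      (θ : Cell W h i) : Rel W (f ◃ (η ⊚ θ)) ((f ◃ η) ⊚ (f ◃ θ))
  | id_whiskerLeft {a b : K} {f g : Word W a b} (η : Cell W f g) :
      Rel W (.id a ◃ η) (.leftUnitor f ⊚ η ⊚ .leftUnitorInv g)
  | comp_whiskerLeft {a b c d : K} (f : Word W a b) (g : Word W b c) {h h' : Word W c d}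
      (η : Cell W h h') :
      Rel W (f.comp g ◃ η) (.assoc f g h ⊚ (f ◃ g ◃ η) ⊚ .assocInv f g h')
  | whiskerRight {a b c : K} (f g : Word W a b) (h : Word W b c) (η η' : Cell W f g) :
      Rel W η η' → Rel W (η ▹ h) (η' ▹ h)
  | id_whiskerRight {a b c : K} (f : Word W a b) (g : Word W b c) :
      Rel W (.id f ▹ g) (.id (f.comp g))
  | comp_whiskerRight {a b c : K} {f g h : Word W a b} (i : Word W b c) (η : Cell W f g)
      (θ : Cell W g h) : Rel W ((η ⊚ θ) ▹ i) ((η ▹ i) ⊚ (θ ▹ i))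
  | whiskerRight_id {a b : K} {f g : Word W a b} (η : Cell W f g) :
      Rel W (η ▹ .id b) (.rightUnitor f ⊚ η ⊚ .rightUnitorInv g)
  | whiskerRight_comp {a b c d : K} {f f' : Word W a b} (g : Word W b c) (h : Word W c d)
      (η : Cell W f f') :
      Rel W (η ▹ g.comp h) (.assocInv f g h ⊚ ((η ▹ g) ▹ h) ⊚ .assoc f' g h)
  | whisker_assoc {a b c d : K} (f : Word W a b) {g g' : Word W b c} (η : Cell W g g')
      (h : Word W c d) :
      Rel W ((f ◃ η) ▹ h) (.assoc f g h ⊚ (f ◃ (η ▹ h)) ⊚ .assocInv f g' h)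
  | whisker_exchange {a b c : K} {f g : Word W a b} {h i : Word W b c} (η : Cell W f g)
      (θ : Cell W h i) : Rel W ((f ◃ θ) ⊚ (η ▹ i)) ((η ▹ h) ⊚ (g ◃ θ))
  | assoc_hom_inv {a b c d : K} (f : Word W a b) (g : Word W b c) (h : Word W c d) :
      Rel W (.assoc f g h ⊚ .assocInv f g h) (.id _)
  | assoc_inv_hom {a b c d : K} (f : Word W a b) (g : Word W b c) (h : Word W c d) :
      Rel W (.assocInv f g h ⊚ .assoc f g h) (.id _)
  | leftUnitor_hom_inv {a b : K} (f : Word W a b) :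
      Rel W (.leftUnitor f ⊚ .leftUnitorInv f) (.id _)
  | leftUnitor_inv_hom {a b : K} (f : Word W a b) :
      Rel W (.leftUnitorInv f ⊚ .leftUnitor f) (.id _)
  | rightUnitor_hom_inv {a b : K} (f : Word W a b) :
      Rel W (.rightUnitor f ⊚ .rightUnitorInv f) (.id _)
  | rightUnitor_inv_hom {a b : K} (f : Word W a b) :
      Rel W (.rightUnitorInv f ⊚ .rightUnitor f) (.id _)
  | pentagon {a b c d e : K} (f : Word W a b) (g : Word W b c) (h : Word W c d)
      (i : Word W d e) :
      Rel W ((.assoc f g h ▹ i) ⊚ .assoc f (g.comp h) i ⊚ (f ◃ .assoc g h i))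
        (.assoc (f.comp g) h i ⊚ .assoc f g (h.comp i))
  | triangle {a b c : K} (f : Word W a b) (g : Word W b c) :
      Rel W (.assoc f (.id b) g ⊚ (f ◃ .leftUnitor g)) (.rightUnitor f ▹ g)
  | of_id {a b : K} (f : a ⟶ b) : Rel W (.of (𝟙 f)) (.id (.of f))
  | of_comp {a b : K} {f g h : a ⟶ b} (η : f ⟶ g) (θ : g ⟶ h) :
      Rel W (.of (η ≫ θ)) (.of η ⊚ .of θ)
  | mapId_hom_inv (a : K) : Rel W (.mapId a ⊚ .mapIdInv a) (.id _)
  | mapId_inv_hom (a : K) : Rel W (.mapIdInv a ⊚ .mapId a) (.id _)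
  | mapComp_hom_inv {a b c : K} (f : a ⟶ b) (g : b ⟶ c) :
      Rel W (.mapComp f g ⊚ .mapCompInv f g) (.id _)
  | mapComp_inv_hom {a b c : K} (f : a ⟶ b) (g : b ⟶ c) :
      Rel W (.mapCompInv f g ⊚ .mapComp f g) (.id _)
  | of_whiskerLeft {a b c : K} (f : a ⟶ b) {g h : b ⟶ c} (η : g ⟶ h) :
      Rel W (.of (f ◁ η)) (.mapComp f g ⊚ (.of f ◃ .of η) ⊚ .mapCompInv f h)
  | of_whiskerRight {a b c : K} {f g : a ⟶ b} (η : f ⟶ g) (h : b ⟶ c) :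
      Rel W (.of (η ▷ h)) (.mapComp f h ⊚ (.of η ▹ .of h) ⊚ .mapCompInv g h)
  | of_associator {a b c d : K} (f : a ⟶ b) (g : b ⟶ c) (h : c ⟶ d) :
      Rel W (.of (α_ f g h).hom) (.mapComp (f ≫ g) h ⊚ (.mapComp f g ▹ .of h) ⊚
        .assoc (.of f) (.of g) (.of h) ⊚ (.of f ◃ .mapCompInv g h) ⊚ .mapCompInv f (g ≫ h))
  | of_leftUnitor {a b : K} (f : a ⟶ b) :
      Rel W (.of (λ_ f).hom) (.mapComp (𝟙 a) f ⊚ (.mapId a ▹ .of f) ⊚ .leftUnitor (.of f))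
  | of_rightUnitor {a b : K} (f : a ⟶ b) :
      Rel W (.of (ρ_ f).hom) (.mapComp f (𝟙 b) ⊚ (.of f ◃ .mapId b) ⊚ .rightUnitor (.of f))
  | unit_hom_inv {a b : K} (f : a ⟶ b) (hf : W f) : Rel W (.unit f hf ⊚ .unitInv f hf) (.id _)
  | unit_inv_hom {a b : K} (f : a ⟶ b) (hf : W f) : Rel W (.unitInv f hf ⊚ .unit f hf) (.id _)
  | counit_hom_inv {a b : K} (f : a ⟶ b) (hf : W f) :
      Rel W (.counit f hf ⊚ .counitInv f hf) (.id _)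
  | counit_inv_hom {a b : K} (f : a ⟶ b) (hf : W f) :
      Rel W (.counitInv f hf ⊚ .counit f hf) (.id _)
  | unit_counit {a b : K} (f : a ⟶ b) (hf : W f) :
      Rel W ((.unit f hf ▹ .of f) ⊚ .assoc (.of f) (.inv f hf) (.of f) ⊚
        (.of f ◃ .counit f hf)) (.leftUnitor (.of f) ⊚ .rightUnitorInv (.of f))

end

variable (W : MorphismProperty K)

instance : CategoryStruct.{max u v} (FormalLoc W) where
  Hom a b := Word W a.as b.as
  id a := Word.id a.as
  comp f g := Word.comp f g

instance (a b : FormalLoc W) : Category.{max u v w} (a ⟶ b) where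
  Hom f g := Quot (Rel W (f := f) (g := g))
  id f := Quot.mk _ (Cell.id f)
  comp := Quot.map₂ Cell.vcomp Rel.vcomp_right Rel.vcomp_left
  id_comp := by rintro f g ⟨η⟩; exact Quot.sound (Rel.id_comp η)
  comp_id := by rintro f g ⟨η⟩; exact Quot.sound (Rel.comp_id η)
  assoc := by rintro f g h i ⟨η⟩ ⟨θ⟩ ⟨ι⟩; exact Quot.sound (Rel.assoc η θ ι)

instance : Bicategory.{max u v w, max u v} (FormalLoc W) where
  whiskerLeft f g h η := Quot.map (Cell.whiskerLeft f) (Rel.whiskerLeft f g h) η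
  whiskerRight {_ _ _ f g} η h := Quot.map (Cell.whiskerRight h) (Rel.whiskerRight f g h) η
  associator f g h :=
    { hom := Quot.mk _ (Cell.assoc f g h)
      inv := Quot.mk _ (Cell.assocInv f g h)
      hom_inv_id := Quot.sound (Rel.assoc_hom_inv f g h)
      inv_hom_id := Quot.sound (Rel.assoc_inv_hom f g h) }
  leftUnitor f :=
    { hom := Quot.mk _ (Cell.leftUnitor f)
      inv := Quot.mk _ (Cell.leftUnitorInv f)
      hom_inv_id := Quot.sound (Rel.leftUnitor_hom_inv f)
      inv_hom_id := Quot.sound (Rel.leftUnitor_inv_hom f) }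
  rightUnitor f :=
    { hom := Quot.mk _ (Cell.rightUnitor f)
      inv := Quot.mk _ (Cell.rightUnitorInv f)
      hom_inv_id := Quot.sound (Rel.rightUnitor_hom_inv f)
      inv_hom_id := Quot.sound (Rel.rightUnitor_inv_hom f) }
  whiskerLeft_id f g := Quot.sound (Rel.whiskerLeft_id f g)
  whiskerLeft_comp := by
    rintro a b c f g h i ⟨η⟩ ⟨θ⟩; exact Quot.sound (Rel.whiskerLeft_comp f η θ)
  id_whiskerLeft := by rintro a b f g ⟨η⟩; exact Quot.sound (Rel.id_whiskerLeft η)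
  comp_whiskerLeft := by
    rintro a b c d f g h h' ⟨η⟩; exact Quot.sound (Rel.comp_whiskerLeft f g η)
  id_whiskerRight f g := Quot.sound (Rel.id_whiskerRight f g)
  comp_whiskerRight := by
    rintro a b c f g h ⟨η⟩ ⟨θ⟩ i; exact Quot.sound (Rel.comp_whiskerRight i η θ)
  whiskerRight_id := by rintro a b f g ⟨η⟩; exact Quot.sound (Rel.whiskerRight_id η)
  whiskerRight_comp := by
    rintro a b c d f f' ⟨η⟩ g h; exact Quot.sound (Rel.whiskerRight_comp g h η)
  whisker_assoc := by
    rintro a b c d f g g' ⟨η⟩ h; exact Quot.sound (Rel.whisker_assoc f η h)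
  whisker_exchange := by
    rintro a b c f g h i ⟨η⟩ ⟨θ⟩; exact Quot.sound (Rel.whisker_exchange η θ)
  pentagon f g h i := Quot.sound (Rel.pentagon f g h i)
  triangle f g := Quot.sound (Rel.triangle f g)

/-- The inclusion of `K` in its formal localisation. -/
def incl : K ⥤ᵖ FormalLoc W where
  obj a := ⟨a⟩
  map f := Word.of f
  map₂ η := Quot.mk _ (Cell.of η)
  map₂_id f := Quot.sound (Rel.of_id f)
  map₂_comp η θ := Quot.sound (Rel.of_comp η θ)
  mapId a :=
    { hom := Quot.mk _ (Cell.mapId a)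
      inv := Quot.mk _ (Cell.mapIdInv a)
      hom_inv_id := Quot.sound (Rel.mapId_hom_inv a)
      inv_hom_id := Quot.sound (Rel.mapId_inv_hom a) }
  mapComp f g :=
    { hom := Quot.mk _ (Cell.mapComp f g)
      inv := Quot.mk _ (Cell.mapCompInv f g)
      hom_inv_id := Quot.sound (Rel.mapComp_hom_inv f g)
      inv_hom_id := Quot.sound (Rel.mapComp_inv_hom f g) }
  map₂_whisker_left f _ _ η := Quot.sound (Rel.of_whiskerLeft f η)
  map₂_whisker_right η h := Quot.sound (Rel.of_whiskerRight η h)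
  map₂_associator f g h := Quot.sound (Rel.of_associator f g h)
  map₂_left_unitor f := Quot.sound (Rel.of_leftUnitor f)
  map₂_right_unitor f := Quot.sound (Rel.of_rightUnitor f)

/-- The formal inverse of an arrow in `W`. -/
def formalInverse {a b : K} (f : a ⟶ b) (hf : W f) : AdjointInverse ((incl W).map f) where
  inv := Word.inv f hf
  unit :=
    { hom := Quot.mk _ (Cell.unit f hf)
      inv := Quot.mk _ (Cell.unitInv f hf)
      hom_inv_id := Quot.sound (Rel.unit_hom_inv f hf)
      inv_hom_id := Quot.sound (Rel.unit_inv_hom f hf) }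
  counit :=
    { hom := Quot.mk _ (Cell.counit f hf)
      inv := Quot.mk _ (Cell.counitInv f hf)
      hom_inv_id := Quot.sound (Rel.counit_hom_inv f hf)
      inv_hom_id := Quot.sound (Rel.counit_inv_hom f hf) }
  triangle := Quot.sound (Rel.unit_counit f hf)

variable {W}

/-- A property of 1-arrows holds for all 1-arrows of the formal localisation if it holds for the
generators and is stable under composition. -/
theorem hom_induction {P : ∀ {a b : K}, ((incl W).obj a ⟶ (incl W).obj b) → Prop}
    (of : ∀ {a b : K} (f : a ⟶ b), P ((incl W).map f))
    (inv : ∀ {a b : K} (f : a ⟶ b) (hf : W f), P (formalInverse W f hf).inv)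
    (id : ∀ a : K, P (𝟙 ((incl W).obj a)))
    (comp : ∀ {a b c : K} (f : (incl W).obj a ⟶ (incl W).obj b)
      (g : (incl W).obj b ⟶ (incl W).obj c), P f → P g → P (f ≫ g))
    {a b : K} (f : (incl W).obj a ⟶ (incl W).obj b) : P f := by
  have key : ∀ {a b : K} (f : Word W a b), P f := by
    intro a b f
    induction f with
    | of f => exact of f
    | inv f hf => exact inv f hf
    | id a => exact id a
    | comp f g hf hg => exact comp _ _ hf hg
  exact key f

/-- A property of 2-arrows holds for all 2-arrows of the formal localisation if it holds for the
generators and their inverses and is stable under composition and whiskering. -/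
theorem cell_induction
    {P : ∀ {a b : K} {f g : (incl W).obj a ⟶ (incl W).obj b}, (f ⟶ g) → Prop}
    (id : ∀ {a b : K} (f : (incl W).obj a ⟶ (incl W).obj b), P (𝟙 f))
    (comp : ∀ {a b : K} {f g h : (incl W).obj a ⟶ (incl W).obj b} (η : f ⟶ g) (θ : g ⟶ h),
      P η → P θ → P (η ≫ θ))
    (whiskerLeft : ∀ {a b c : K} (f : (incl W).obj a ⟶ (incl W).obj b)
      {g h : (incl W).obj b ⟶ (incl W).obj c} (η : g ⟶ h), P η → P (f ◁ η))
    (whiskerRight : ∀ {a b c : K} {f g : (incl W).obj a ⟶ (incl W).obj b} (η : f ⟶ g)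
      (h : (incl W).obj b ⟶ (incl W).obj c), P η → P (η ▷ h))
    (assoc : ∀ {a b c d : K} (f : (incl W).obj a ⟶ (incl W).obj b)
      (g : (incl W).obj b ⟶ (incl W).obj c) (h : (incl W).obj c ⟶ (incl W).obj d),
      P (α_ f g h).hom ∧ P (α_ f g h).inv)
    (leftUnitor : ∀ {a b : K} (f : (incl W).obj a ⟶ (incl W).obj b),
      P (λ_ f).hom ∧ P (λ_ f).inv)
    (rightUnitor : ∀ {a b : K} (f : (incl W).obj a ⟶ (incl W).obj b),
      P (ρ_ f).hom ∧ P (ρ_ f).inv)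
    (of : ∀ {a b : K} {f g : a ⟶ b} (η : f ⟶ g), P ((incl W).map₂ η))
    (mapId : ∀ a : K, P ((incl W).mapId a).hom ∧ P ((incl W).mapId a).inv)
    (mapComp : ∀ {a b c : K} (f : a ⟶ b) (g : b ⟶ c),
      P ((incl W).mapComp f g).hom ∧ P ((incl W).mapComp f g).inv)
    (unit : ∀ {a b : K} (f : a ⟶ b) (hf : W f),
      P (formalInverse W f hf).unit.hom ∧ P (formalInverse W f hf).unit.inv)
    (counit : ∀ {a b : K} (f : a ⟶ b) (hf : W f),
      P (formalInverse W f hf).counit.hom ∧ P (formalInverse W f hf).counit.inv)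
    {a b : K} {f g : (incl W).obj a ⟶ (incl W).obj b} (η : f ⟶ g) : P η := by
  have key : ∀ {a b : K} {f g : Word W a b} (η : Cell W f g),
      P (f := f) (g := g) (Quot.mk _ η) := by
    intro a b f g η
    induction η with
    | id f => exact id f
    | vcomp η θ h₁ h₂ => exact comp (Quot.mk _ η) (Quot.mk _ θ) h₁ h₂
    | whiskerLeft f η h => exact whiskerLeft f (Quot.mk _ η) h
    | whiskerRight h η h₁ => exact whiskerRight (Quot.mk _ η) h h₁
    | assoc f g h => exact (assoc f g h).1
    | assocInv f g h => exact (assoc f g h).2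
    | leftUnitor f => exact (leftUnitor f).1
    | leftUnitorInv f => exact (leftUnitor f).2
    | rightUnitor f => exact (rightUnitor f).1
    | rightUnitorInv f => exact (rightUnitor f).2
    | of η => exact of η
    | mapId a => exact (mapId a).1
    | mapIdInv a => exact (mapId a).2
    | mapComp f g => exact (mapComp f g).1
    | mapCompInv f g => exact (mapComp f g).2
    | unit f hf => exact (unit f hf).1
    | unitInv f hf => exact (unit f hf).2
    | counit f hf => exact (counit f hf).1
    | counitInv f hf => exact (counit f hf).2
  obtain ⟨η⟩ := η
  exact key η

/-! ### Extension of 2-functors -/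

section Lift

variable {A : Type uA} [Bicategory.{wA, vA} A] (F : K ⥤ᵖ A)
  (e : ∀ ⦃a b : K⦄ (f : a ⟶ b), W f → AdjointInverse (F.map f))

/-- The extension of a pseudofunctor to words, given inverses of the images of arrows in `W`. -/
def liftWord : ∀ {a b : K}, Word W a b → (F.obj a ⟶ F.obj b)
  | _, _, .of f => F.map f
  | _, _, .inv f hf => (e f hf).inv
  | _, _, .id _ => 𝟙 _
  | _, _, .comp f g => liftWord f ≫ liftWord g

/-- The extension of a pseudofunctor to representatives of 2-arrows. -/
def liftCell : ∀ {a b : K} {f g : Word W a b}, Cell W f g → (liftWord F e f ⟶ liftWord F e g)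
  | _, _, _, _, .id _ => 𝟙 _
  | _, _, _, _, .vcomp η θ => liftCell η ≫ liftCell θ
  | _, _, _, _, .whiskerLeft f η => liftWord F e f ◁ liftCell η
  | _, _, _, _, .whiskerRight h η => liftCell η ▷ liftWord F e h
  | _, _, _, _, .assoc f g h => (α_ (liftWord F e f) (liftWord F e g) (liftWord F e h)).hom
  | _, _, _, _, .assocInv f g h => (α_ (liftWord F e f) (liftWord F e g) (liftWord F e h)).inv
  | _, _, _, _, .leftUnitor f => (λ_ (liftWord F e f)).hom
  | _, _, _, _, .leftUnitorInv f => (λ_ (liftWord F e f)).inv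
  | _, _, _, _, .rightUnitor f => (ρ_ (liftWord F e f)).hom
  | _, _, _, _, .rightUnitorInv f => (ρ_ (liftWord F e f)).inv
  | _, _, _, _, .of η => F.map₂ η
  | _, _, _, _, .mapId a => (F.mapId a).hom
  | _, _, _, _, .mapIdInv a => (F.mapId a).inv
  | _, _, _, _, .mapComp f g => (F.mapComp f g).hom
  | _, _, _, _, .mapCompInv f g => (F.mapComp f g).inv
  | _, _, _, _, .unit f hf => (e f hf).unit.hom
  | _, _, _, _, .unitInv f hf => (e f hf).unit.inv
  | _, _, _, _, .counit f hf => (e f hf).counit.hom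
  | _, _, _, _, .counitInv f hf => (e f hf).counit.inv

theorem liftCell_eq_of_rel {a b : K} {f g : Word W a b} {η θ : Cell W f g} (h : Rel W η θ) :
    liftCell F e η = liftCell F e θ := by
  induction h with
  | vcomp_right η θ₁ θ₂ _ ih => exact congrArg (liftCell F e η ≫ ·) ih
  | vcomp_left η₁ η₂ θ _ ih => exact congrArg (· ≫ liftCell F e θ) ih
  | whiskerLeft f g h η η' _ ih => exact congrArg (liftWord F e f ◁ ·) ih
  | whiskerRight f g h η η' _ ih => exact congrArg (· ▷ liftWord F e h) ih
  | whisker_exchange η θ => exact whisker_exchange _ _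
  | unit_counit f hf => exact (e f hf).triangle
  | _ => simp [liftCell, liftWord]

/-- The extension of a pseudofunctor that inverts `W` to the formal localisation. -/
def lift : FormalLoc W ⥤ᵖ A where
  obj a := F.obj a.as
  map f := liftWord F e f
  map₂ := Quot.lift (liftCell F e) (fun _ _ h => liftCell_eq_of_rel F e h)
  map₂_id _ := rfl
  map₂_comp := by rintro _ _ _ _ _ ⟨η⟩ ⟨θ⟩; rfl
  mapId _ := Iso.refl _
  mapComp _ _ := Iso.refl _
  map₂_whisker_left := by
    rintro a b c f g h ⟨η⟩
    exact ((Category.id_comp _).trans (Category.comp_id _)).symm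
  map₂_whisker_right := by
    rintro a b c f g ⟨η⟩ h
    exact ((Category.id_comp _).trans (Category.comp_id _)).symm
  map₂_associator f g h := by
    change (α_ (liftWord F e f) (liftWord F e g) (liftWord F e h)).hom =
      𝟙 _ ≫ 𝟙 _ ▷ liftWord F e h ≫ (α_ _ _ _).hom ≫ liftWord F e f ◁ 𝟙 _ ≫ 𝟙 _
    simp
  map₂_left_unitor f := by
    change (λ_ (liftWord F e f)).hom = 𝟙 _ ≫ 𝟙 _ ▷ liftWord F e f ≫ (λ_ _).hom
    simp
  map₂_right_unitor f := by
    change (ρ_ (liftWord F e f)).hom = 𝟙 _ ≫ liftWord F e f ◁ 𝟙 _ ≫ (ρ_ _).hom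
    simp

end Lift

end FormalLoc

end TwoSite

namespace TwoSite

/-! ### Equivalences in a bicategory -/

section Equivalences

variable {B : Type*} [Bicategory B]

theorem IsEquiv.isEquivalence_postcomp {a b : B} {f : a ⟶ b} (hf : IsEquiv f) (z : B) :
    (postcomp z f).IsEquivalence := by
  obtain ⟨g, ⟨η⟩, ⟨θ⟩⟩ := hf
  exact (CategoryTheory.Equivalence.mk (postcomp z f) (postcomp z g)
    ((rightUnitorNatIso z a).symm ≪≫ (postcomposing z a a).mapIso η.symm ≪≫
      (associatorNatIsoLeft z f g).symm)
    (associatorNatIsoLeft z g f ≪≫ (postcomposing z b b).mapIso θ ≪≫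
      rightUnitorNatIso z b)).isEquivalence_functor

theorem IsEquiv.isEquivalence_precomp {a b : B} {f : a ⟶ b} (hf : IsEquiv f) (z : B) :
    (precomp z f).IsEquivalence := by
  obtain ⟨g, ⟨η⟩, ⟨θ⟩⟩ := hf
  exact (CategoryTheory.Equivalence.mk (precomp z f) (precomp z g)
    ((leftUnitorNatIso b z).symm ≪≫ (precomposing b b z).mapIso θ.symm ≪≫
      (associatorNatIsoRight g f z))
    ((associatorNatIsoRight f g z).symm ≪≫ (precomposing a a z).mapIso η ≪≫
      leftUnitorNatIso a z)).isEquivalence_functor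

theorem IsEquiv.whiskerLeft_injective {a b c : B} {f : a ⟶ b} (hf : IsEquiv f) {g h : b ⟶ c}
    {η θ : g ⟶ h} (H : f ◁ η = f ◁ θ) : η = θ :=
  have := hf.isEquivalence_precomp c
  (precomp c f).map_injective H

theorem IsEquiv.whiskerRight_injective {a b c : B} {f : b ⟶ c} (hf : IsEquiv f) {g h : a ⟶ b}
    {η θ : g ⟶ h} (H : η ▷ f = θ ▷ f) : η = θ :=
  have := hf.isEquivalence_postcomp a
  (postcomp a f).map_injective H

theorem IsEquiv.exists_whiskerRightIso_eq {a b c : B} {f : b ⟶ c} (hf : IsEquiv f) {g h : a ⟶ b}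
    (η : g ≫ f ≅ h ≫ f) : ∃ θ : g ≅ h, whiskerRightIso θ f = η := by
  have := hf.isEquivalence_postcomp a
  exact ⟨(postcomp a f).preimageIso η, by ext; exact (postcomp a f).map_preimage η.hom⟩

theorem IsEquiv.nonempty_iso_of_comp {a b c : B} {f : a ⟶ b} (hf : IsEquiv f) {g h : b ⟶ c}
    (η : f ≫ g ≅ f ≫ h) : Nonempty (g ≅ h) :=
  have := hf.isEquivalence_precomp c
  ⟨(precomp c f).preimageIso η⟩

theorem IsEquiv.map {C : Type*} [Bicategory C] (F : B ⥤ᵖ C) {a b : B} {f : a ⟶ b}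
    (hf : IsEquiv f) : IsEquiv (F.map f) := by
  obtain ⟨g, ⟨η⟩, ⟨θ⟩⟩ := hf
  exact ⟨F.map g, ⟨(F.mapComp f g).symm ≪≫ F.map₂Iso η ≪≫ F.mapId a⟩,
    ⟨(F.mapComp g f).symm ≪≫ F.map₂Iso θ ≪≫ F.mapId b⟩⟩

theorem IsEquiv.of_iso {a b : B} {f g : a ⟶ b} (hf : IsEquiv f) (i : f ≅ g) : IsEquiv g := by
  obtain ⟨h, ⟨η⟩, ⟨θ⟩⟩ := hf
  exact ⟨h, ⟨whiskerRightIso i.symm h ≪≫ η⟩, ⟨whiskerLeftIso h i.symm ≪≫ θ⟩⟩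

end Equivalences

/-! ### Extension of modifications -/

section Naturality

variable {B C : Type*} [Bicategory B] [Bicategory C] {G H : B ⥤ᵖ C} {θ ι : G ⟶ H}
  (γ : ∀ a, θ.app a ⟶ ι.app a)

/-- The condition on a family `γ` of 2-arrows for being a modification, at the 1-arrow `f`. -/
def IsModificationAt {a b : B} (f : a ⟶ b) : Prop :=
  G.map f ◁ γ b ≫ (ι.naturality f).hom = (θ.naturality f).hom ≫ γ a ▷ H.map f

variable {γ}

theorem isModificationAt_of_iso {a b : B} {f g : a ⟶ b} (i : f ≅ g)
    (h : IsModificationAt γ f) : IsModificationAt γ g := by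
  unfold IsModificationAt at *
  rw [ι.naturality_naturality_hom i, θ.naturality_naturality_hom i, whisker_exchange_assoc,
    reassoc_of% h]
  simp [whisker_exchange]

theorem isModificationAt_id (a : B) : IsModificationAt γ (𝟙 a) := by
  unfold IsModificationAt
  rw [ι.naturality_id_hom, θ.naturality_id_hom, whisker_exchange_assoc]
  simp [whisker_exchange]

/-- If `γ` satisfies the condition at `g`, then the condition at `f ≫ g` is the condition at `f`
whiskered with `H g`. For `g` an equivalence the latter is the condition at `f`, which yields the
condition at an inverse of an arrow from the one at the arrow. -/
theorem isModificationAt_comp_iff {a b c : B} (f : a ⟶ b) (g : b ⟶ c)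
    (hg : IsModificationAt γ g) : IsModificationAt γ (f ≫ g) ↔
      (G.map f ◁ γ b ≫ (ι.naturality f).hom) ▷ H.map g =
        ((θ.naturality f).hom ≫ γ a ▷ H.map f) ▷ H.map g := by
  unfold IsModificationAt at *
  rw [ι.naturality_comp_hom, θ.naturality_comp_hom, whisker_exchange_assoc]
  have h₁ : (G.map f ≫ G.map g) ◁ γ c ≫ (α_ (G.map f) (G.map g) (ι.app c)).hom ≫
      G.map f ◁ (ι.naturality g).hom = (α_ _ _ _).hom ≫ G.map f ◁ (θ.naturality g).hom ≫
        G.map f ◁ γ b ▷ H.map g := by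
    rw [← whiskerLeft_comp, ← hg]
    simp
  have h₂ : (α_ _ _ _).hom ≫ θ.app a ◁ (H.mapComp f g).inv ≫ γ a ▷ H.map (f ≫ g) =
      γ a ▷ H.map f ▷ H.map g ≫ (α_ _ _ _).hom ≫ ι.app a ◁ (H.mapComp f g).inv := by
    rw [whisker_exchange]
    simp
  have h₃ : G.map f ◁ γ b ▷ H.map g ≫ (α_ _ _ _).inv ≫ (ι.naturality f).hom ▷ H.map g =
      (α_ _ _ _).inv ≫ (G.map f ◁ γ b ≫ (ι.naturality f).hom) ▷ H.map g := by
    simp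
  simp only [Category.assoc]
  rw [reassoc_of% h₁, h₂, reassoc_of% h₃, cancel_epi, cancel_epi, cancel_epi, cancel_epi,
    ← Category.assoc, ← Category.assoc, ← Category.assoc, cancel_mono, cancel_mono,
    comp_whiskerRight (θ.naturality f).hom]

end Naturality

/-- Pseudofunctors are equal if their underlying prelax functors and their structural 2-arrows
are. -/
theorem pseudofunctor_ext {B C : Type*} [Bicategory B] [Bicategory C] (F G : B ⥤ᵖ C) (h : F.toPrelaxFunctor = G.toPrelaxFunctor)
    (hId : ∀ a, HEq (F.mapId a) (G.mapId a))
    (hComp : ∀ ⦃a b c : B⦄ (f : a ⟶ b) (g : b ⟶ c), HEq (F.mapComp f g) (G.mapComp f g)) :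
    F = G := by
  obtain ⟨F, i, c⟩ := F
  obtain ⟨G, i', c'⟩ := G
  obtain rfl : F = G := h
  obtain rfl : i = i' := funext fun a => eq_of_heq (hId a)
  obtain rfl : @c = @c' := by
    funext a b c f g
    exact eq_of_heq (hComp f g)
  rfl

namespace FormalLoc
variable {K : Type u} [Bicategory.{w, v} K] {W : MorphismProperty K}

theorem inverts_incl : Inverts (incl W) W := fun _ _ f hf => (formalInverse W f hf).isEquiv

section Lift
variable {A : Type uA} [Bicategory.{wA, vA} A]

variable (F : K ⥤ᵖ A)
  (e : ∀ ⦃a b : K⦄ (f : a ⟶ b), W f → AdjointInverse (F.map f))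
/-- The extension restricts to the given 2-functor on the nose, although its structural 2-arrows
are composites with identities. -/
theorem incl_comp_lift : (incl W).comp (lift F e) = F :=
  pseudofunctor_ext _ _ rfl
    (fun a => heq_of_eq (Iso.ext (Category.comp_id (F.mapId a).hom)))
    (fun _ _ _ f g => heq_of_eq (Iso.ext (Category.comp_id (F.mapComp f g).hom)))

end Lift

variable {A : Type uA} [Bicategory.{wA, vA} A] {G H : FormalLoc W ⥤ᵖ A}

instance faithful_precomposition : ((precomposition (incl W) A).mapFunctor G H).Faithful where
  map_injective {_ _ _ _} h := by
    ext a
    exact congrArg (fun Γ => Γ.as.app a.as) h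

instance full_precomposition : ((precomposition (incl W) A).mapFunctor G H).Full where
  map_surjective {θ ι} Γ := by
    have nat_of {a b : K} (f : a ⟶ b) : IsModificationAt (θ := θ) (ι := ι)
        (fun a => Γ.as.app a.as) ((incl W).map f) := Γ.as.naturality f
    have nat : ∀ {a b : K} (f : (incl W).obj a ⟶ (incl W).obj b),
        IsModificationAt (θ := θ) (ι := ι) (fun a => Γ.as.app a.as) f := by
      intro a b f
      induction f using hom_induction with
      | of f => exact nat_of f
      | id a => exact isModificationAt_id ((incl W).obj a)
      | comp f g hf hg => exact (isModificationAt_comp_iff f g hg).2 (congrArg (· ▷ H.map g) hf)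
      | inv f hf =>
        -- The composite of the formal inverse with `f` is isomorphic to an identity.
        exact ((inverts_incl f hf).map H).whiskerRight_injective
          ((isModificationAt_comp_iff _ _ (nat_of f)).1
            (isModificationAt_of_iso (formalInverse W f hf).counit.symm (isModificationAt_id _)))
    exact ⟨⟨⟨fun a => Γ.as.app a.as, nat⟩⟩, rfl⟩

end FormalLoc
end TwoSite

namespace TwoSite

/-! ### Naturality constraints of transformations -/

section Squares

variable {B C : Type*} [Bicategory B] [Bicategory C] {G H : B ⥤ᵖ C}

/-- The naturality constraint of a transformation with components `p` and `r` at a composite,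
built from its constraints at the factors. -/
def naturalityComp {a b c : B} {f : a ⟶ b} {g : b ⟶ c} {p : G.obj a ⟶ H.obj a}
    {q : G.obj b ⟶ H.obj b} {r : G.obj c ⟶ H.obj c} (s : G.map f ≫ q ≅ p ≫ H.map f)
    (t : G.map g ≫ r ≅ q ≫ H.map g) : G.map (f ≫ g) ≫ r ≅ p ≫ H.map (f ≫ g) :=
  whiskerRightIso (G.mapComp f g) r ≪≫ α_ _ _ _ ≪≫ whiskerLeftIso (G.map f) t ≪≫
    (α_ _ _ _).symm ≪≫ whiskerRightIso s (H.map g) ≪≫ α_ _ _ _ ≪≫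
    whiskerLeftIso p (H.mapComp f g).symm

/-- The naturality constraint of a transformation with component `p` at an identity. -/
def naturalityId {a : B} (p : G.obj a ⟶ H.obj a) : G.map (𝟙 a) ≫ p ≅ p ≫ H.map (𝟙 a) :=
  whiskerRightIso (G.mapId a) p ≪≫ λ_ p ≪≫ (ρ_ p).symm ≪≫ whiskerLeftIso p (H.mapId a).symm

/-- Compatibility of naturality constraints at `f` and at `g` with a 2-arrow `η : f ⟶ g`. -/
def IsNatural {a b : B} {f g : a ⟶ b} {p : G.obj a ⟶ H.obj a} {q : G.obj b ⟶ H.obj b}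
    (s : G.map f ≫ q ≅ p ≫ H.map f) (t : G.map g ≫ q ≅ p ≫ H.map g) (η : f ⟶ g) : Prop :=
  G.map₂ η ▷ q ≫ t.hom = s.hom ≫ p ◁ H.map₂ η

section

variable {a b c d : B} {p : G.obj a ⟶ H.obj a} {q : G.obj b ⟶ H.obj b} {r : G.obj c ⟶ H.obj c}
  {k : G.obj d ⟶ H.obj d}

theorem isNatural_id {f : a ⟶ b} (s : G.map f ≫ q ≅ p ≫ H.map f) : IsNatural s s (𝟙 f) := by
  simp [IsNatural]

theorem IsNatural.comp {f g h : a ⟶ b} {s : G.map f ≫ q ≅ p ≫ H.map f}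
    {t : G.map g ≫ q ≅ p ≫ H.map g} {u : G.map h ≫ q ≅ p ≫ H.map h} {η : f ⟶ g} {θ : g ⟶ h}
    (hη : IsNatural s t η) (hθ : IsNatural t u θ) : IsNatural s u (η ≫ θ) := by
  unfold IsNatural at *
  simp [hθ, reassoc_of% hη]

theorem IsNatural.symm {f g : a ⟶ b} {s : G.map f ≫ q ≅ p ≫ H.map f}
    {t : G.map g ≫ q ≅ p ≫ H.map g} {η : f ≅ g} (hη : IsNatural s t η.hom) :
    IsNatural t s η.inv := by
  unfold IsNatural at *
  have : G.map₂ η.inv ▷ q ≫ G.map₂ η.hom ▷ q = 𝟙 _ := by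
    simp [← comp_whiskerRight, ← PrelaxFunctor.map₂_comp]
  have h' : p ◁ H.map₂ η.hom ≫ p ◁ H.map₂ η.inv = 𝟙 _ := by
    simp [← whiskerLeft_comp, ← PrelaxFunctor.map₂_comp]
  rw [← Category.comp_id s.hom, ← h', ← reassoc_of% hη, reassoc_of% this]

/-- Conjugation with `i` transports a naturality constraint from `g` to `f`. -/
theorem isNatural_conj {f g : a ⟶ b} (i : f ≅ g) (t : G.map g ≫ q ≅ p ≫ H.map g) :
    IsNatural (whiskerRightIso (G.map₂Iso i) q ≪≫ t ≪≫ whiskerLeftIso p (H.map₂Iso i).symm) t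
      i.hom := by
  have : p ◁ H.map₂ i.inv ≫ p ◁ H.map₂ i.hom = 𝟙 _ := by
    simp [← whiskerLeft_comp, ← PrelaxFunctor.map₂_comp]
  simp [IsNatural, this]

theorem isNatural_whiskerLeft {f : a ⟶ b} {g h : b ⟶ c} (s : G.map f ≫ q ≅ p ≫ H.map f)
    {t : G.map g ≫ r ≅ q ≫ H.map g} {u : G.map h ≫ r ≅ q ≫ H.map h} {η : g ⟶ h}
    (hη : IsNatural t u η) : IsNatural (naturalityComp s t) (naturalityComp s u) (f ◁ η) := by
  unfold IsNatural at *
  have h₁ : G.map f ◁ G.map₂ η ▷ r ≫ G.map f ◁ u.hom =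
    G.map f ◁ t.hom ≫ G.map f ◁ q ◁ H.map₂ η := by
    rw [← whiskerLeft_comp, hη, whiskerLeft_comp]
  have h₂ : s.hom ▷ H.map g ≫ (α_ _ _ _).hom ≫ p ◁ H.map f ◁ H.map₂ η =
      (G.map f ≫ q) ◁ H.map₂ η ≫ s.hom ▷ H.map h ≫ (α_ _ _ _).hom := by
    rw [whisker_exchange_assoc]; simp
  simp [naturalityComp, reassoc_of% h₁, reassoc_of% h₂]

/-- Compatibility with `η ▷ h` is compatibility with `η` whiskered with `H h`. -/
theorem isNatural_whiskerRight_iff {f g : a ⟶ b} {h : b ⟶ c} {s : G.map f ≫ q ≅ p ≫ H.map f}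
    {t : G.map g ≫ q ≅ p ≫ H.map g} (u : G.map h ≫ r ≅ q ≫ H.map h) {η : f ⟶ g} :
    IsNatural (naturalityComp s u) (naturalityComp t u) (η ▷ h) ↔
      (G.map₂ η ▷ q ≫ t.hom) ▷ H.map h = (s.hom ≫ p ◁ H.map₂ η) ▷ H.map h := by
  unfold IsNatural at *
  have h₁ : G.map₂ η ▷ G.map h ▷ r ≫ (α_ _ _ _).hom ≫ G.map g ◁ u.hom ≫ (α_ _ _ _).inv =
     (α_ _ _ _).hom ≫ G.map f ◁ u.hom ≫ (α_ _ _ _).inv ≫ G.map₂ η ▷ q ▷ H.map h := by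
    rw [associator_naturality_left_assoc, ← whisker_exchange_assoc,
      associator_inv_naturality_left]
  have h₂ : (α_ _ _ _).hom ≫ p ◁ (H.mapComp f h).inv ≫ p ◁ H.map₂ (η ▷ h) =
      (p ◁ H.map₂ η) ▷ H.map h ≫ (α_ _ _ _).hom ≫ p ◁ (H.mapComp g h).inv := by
    simp
  have h₃ : G.map₂ (η ▷ h) ▷ r ≫ (G.mapComp g h).hom ▷ r =
      (G.mapComp f h).hom ▷ r ≫ G.map₂ η ▷ G.map h ▷ r := by
    simp [← comp_whiskerRight]
  simp only [naturalityComp, Iso.trans_hom, whiskerRightIso_hom, whiskerLeftIso_hom,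
    Iso.symm_hom, Category.assoc]
  rw [h₂, reassoc_of% h₃, reassoc_of% h₁, cancel_epi, cancel_epi, cancel_epi, cancel_epi,
    ← Category.assoc, ← Category.assoc, ← Category.assoc, ← Category.assoc, cancel_mono,
    cancel_mono, comp_whiskerRight, comp_whiskerRight]

theorem isNatural_whiskerRight {f g : a ⟶ b} {h : b ⟶ c} {s : G.map f ≫ q ≅ p ≫ H.map f}
    {t : G.map g ≫ q ≅ p ≫ H.map g} (u : G.map h ≫ r ≅ q ≫ H.map h) {η : f ⟶ g}
    (hη : IsNatural s t η) : IsNatural (naturalityComp s u) (naturalityComp t u) (η ▷ h) :=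
  (isNatural_whiskerRight_iff u).2 (congrArg (· ▷ H.map h) hη)

theorem IsNatural.of_whiskerRight {f g : a ⟶ b} {h : b ⟶ c} {s : G.map f ≫ q ≅ p ≫ H.map f}
    {t : G.map g ≫ q ≅ p ≫ H.map g} {u : G.map h ≫ r ≅ q ≫ H.map h} {η : f ⟶ g}
    (hh : IsEquiv h)
    (hη : IsNatural (naturalityComp s u) (naturalityComp t u) (η ▷ h)) : IsNatural s t η :=
  (hh.map H).whiskerRight_injective ((isNatural_whiskerRight_iff u).1 hη)

theorem isNatural_associator {f : a ⟶ b} {g : b ⟶ c} {h : c ⟶ d}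
    (s : G.map f ≫ q ≅ p ≫ H.map f) (t : G.map g ≫ r ≅ q ≫ H.map g)
    (u : G.map h ≫ k ≅ r ≫ H.map h) :
    IsNatural (naturalityComp (naturalityComp s t) u) (naturalityComp s (naturalityComp t u))
      (α_ f g h).hom := by
  unfold IsNatural naturalityComp
  have h₁ : G.map (f ≫ g) ◁ u.hom ≫ (α_ _ _ _).inv ≫ (G.mapComp f g).hom ▷ r ▷ H.map h =
      (G.mapComp f g).hom ▷ (G.map h ≫ k) ≫ (G.map f ≫ G.map g) ◁ u.hom ≫ (α_ _ _ _).inv := by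
    rw [← associator_inv_naturality_left, whisker_exchange_assoc]
  have h₂ : G.map f ◁ q ◁ (H.mapComp g h).inv ≫ (α_ _ _ _).inv ≫ s.hom ▷ H.map (g ≫ h) ≫
      (α_ p (H.map f) (H.map (g ≫ h))).hom = (α_ _ _ _).inv ≫ s.hom ▷ (H.map g ≫ H.map h) ≫
        (α_ _ _ _).hom ≫ p ◁ H.map f ◁ (H.mapComp g h).inv := by
    rw [associator_inv_naturality_right_assoc, whisker_exchange_assoc]
    simp
  simp [reassoc_of% h₁, reassoc_of% h₂]

theorem isNatural_leftUnitor {f : a ⟶ b} (s : G.map f ≫ q ≅ p ≫ H.map f) :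
    IsNatural (naturalityComp (naturalityId p) s) s (λ_ f).hom := by
  unfold IsNatural naturalityComp naturalityId
  have h₁ : G.map (𝟙 a) ◁ s.hom ≫ (α_ _ _ _).inv ≫ (G.mapId a).hom ▷ p ▷ H.map f =
      (G.mapId a).hom ▷ (G.map f ≫ q) ≫ 𝟙 _ ◁ s.hom ≫ (α_ _ _ _).inv := by
    rw [← associator_inv_naturality_left, whisker_exchange_assoc]
  simp [reassoc_of% h₁]

theorem isNatural_rightUnitor {f : a ⟶ b} (s : G.map f ≫ q ≅ p ≫ H.map f) :
    IsNatural (naturalityComp s (naturalityId q)) s (ρ_ f).hom := by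
  unfold IsNatural naturalityComp naturalityId
  have h₁ : s.hom ▷ H.map (𝟙 b) ≫ (α_ p (H.map f) (H.map (𝟙 b))).hom ≫
      p ◁ H.map f ◁ (H.mapId b).hom = (α_ _ _ _).hom ≫ G.map f ◁ q ◁ (H.mapId b).hom ≫
        (α_ _ _ _).inv ≫ s.hom ▷ 𝟙 _ ≫ (α_ _ _ _).hom := by
    rw [associator_inv_naturality_right_assoc, whisker_exchange_assoc]
    simp
  simp [reassoc_of% h₁]

/-- A naturality constraint at `f ≫ g` and one at an equivalence `g` come from a constraint at
`f`. -/
theorem exists_naturalityComp_eq {f : a ⟶ b} {g : b ⟶ c} (hg : IsEquiv g)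
    (t : G.map g ≫ r ≅ q ≫ H.map g) (x : G.map (f ≫ g) ≫ r ≅ p ≫ H.map (f ≫ g)) :
    ∃ s : G.map f ≫ q ≅ p ≫ H.map f, naturalityComp s t = x := by
  obtain ⟨s, hs⟩ := (hg.map H).exists_whiskerRightIso_eq (α_ (G.map f) q (H.map g) ≪≫
    whiskerLeftIso (G.map f) t.symm ≪≫ (α_ _ _ _).symm ≪≫
    (whiskerRightIso (G.mapComp f g) r).symm ≪≫ x ≪≫ whiskerLeftIso p (H.mapComp f g) ≪≫
    (α_ _ _ _).symm)
  refine ⟨s, ?_⟩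
  rw [naturalityComp, hs]
  ext
  simp

end

end Squares
end TwoSite

namespace TwoSite
namespace FormalLoc
variable {K : Type u} [Bicategory.{w, v} K] {W : MorphismProperty K}
  {A : Type uA} [Bicategory.{wA, vA} A] {G H : FormalLoc W ⥤ᵖ A}

/-! ### The universal property of the formal localisation -/

section Extend

variable (θ : (incl W).comp G ⟶ (incl W).comp H)

/-- The component of `θ` at `a`, as a 1-arrow between values of `G` and `H`. -/
def component (a : FormalLoc W) : G.obj a ⟶ H.obj a := θ.app a.as

/-- The naturality constraint of `θ`, as a 2-arrow between values of `G` and `H`. -/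
def naturalityOf {a b : K} (f : a ⟶ b) :
    G.map ((incl W).map f) ≫ component θ ((incl W).obj b) ≅
      component θ ((incl W).obj a) ≫ H.map ((incl W).map f) :=
  θ.naturality f

theorem exists_naturalityInv {a b : K} (f : a ⟶ b) (hf : W f) :
    ∃ s : G.map (formalInverse W f hf).inv ≫ component θ ((incl W).obj a) ≅
      component θ ((incl W).obj b) ≫ H.map (formalInverse W f hf).inv,
    IsNatural (naturalityComp s (naturalityOf θ f)) (naturalityId (component θ ((incl W).obj b)))
      (formalInverse W f hf).counit.hom := by
  obtain ⟨s, hs⟩ := exists_naturalityComp_eq (inverts_incl f hf) (naturalityOf θ f)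
    (whiskerRightIso (G.map₂Iso (formalInverse W f hf).counit) (component θ ((incl W).obj b)) ≪≫
      naturalityId (component θ ((incl W).obj b)) ≪≫
      whiskerLeftIso (component θ ((incl W).obj b)) (H.map₂Iso (formalInverse W f hf).counit).symm)
  exact ⟨s, hs ▸ isNatural_conj _ _⟩

/-- The naturality constraint at the formal inverse of `f`, chosen so as to be compatible with the
counit. -/
noncomputable def naturalityInv {a b : K} (f : a ⟶ b) (hf : W f) :
    G.map (formalInverse W f hf).inv ≫ component θ ((incl W).obj a) ≅
      component θ ((incl W).obj b) ≫ H.map (formalInverse W f hf).inv :=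
  (exists_naturalityInv θ f hf).choose

/-- The naturality constraints at words of a transformation given on `K`. -/
noncomputable def naturalityWord : ∀ {a b : K} (f : Word W a b),
    G.map (X := ⟨a⟩) (Y := ⟨b⟩) f ≫ component θ ((incl W).obj b) ≅
      component θ ((incl W).obj a) ≫ H.map (X := ⟨a⟩) (Y := ⟨b⟩) f
  | _, _, .of f => naturalityOf θ f
  | _, _, .inv f hf => naturalityInv θ f hf
  | _, _, .id a => naturalityId (component θ ((incl W).obj a))
  | _, _, .comp f g => naturalityComp (naturalityWord f) (naturalityWord g)

/-- The naturality constraints on the formal localisation of a transformation given on `K`. -/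
noncomputable def extendNaturality {a b : FormalLoc W} (f : a ⟶ b) :
    G.map f ≫ component θ b ≅ component θ a ≫ H.map f := naturalityWord θ f

/-- The constraints are natural in all 2-arrows. By induction this reduces to the generators, where
it holds by assumption on `θ` or by the choice made at formal inverses. -/
theorem isNatural_extendNaturality {a b : K} {f g : (incl W).obj a ⟶ (incl W).obj b} (η : f ⟶ g) :
    IsNatural (extendNaturality θ f) (extendNaturality θ g) η := by
  have counit {a b : K} (f : a ⟶ b) (hf : W f) :
      IsNatural (naturalityComp (naturalityInv θ f hf) (naturalityOf θ f))
        (naturalityId (component θ ((incl W).obj b))) (formalInverse W f hf).counit.hom :=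
    (exists_naturalityInv θ f hf).choose_spec
  induction η using cell_induction with
  | id f => exact isNatural_id _
  | comp η θ h₁ h₂ => exact h₁.comp h₂
  | whiskerLeft f η h => exact isNatural_whiskerLeft _ h
  | whiskerRight η h h₁ => exact isNatural_whiskerRight _ h₁
  | assoc f g h => exact ⟨isNatural_associator _ _ _, (isNatural_associator _ _ _).symm⟩
  | leftUnitor f => exact ⟨isNatural_leftUnitor _, (isNatural_leftUnitor _).symm⟩
  | rightUnitor f => exact ⟨isNatural_rightUnitor _, (isNatural_rightUnitor _).symm⟩
  | of η => exact θ.naturality_naturality η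
  | mapId a =>
    have h : IsNatural (naturalityOf θ (𝟙 a)) (naturalityId (component θ ((incl W).obj a)))
        ((incl W).mapId a).hom := by
      have h₁ : (naturalityOf θ (𝟙 a)).hom ≫ component θ ((incl W).obj a) ◁
          (H.map₂ ((incl W).mapId a).hom ≫ (H.mapId ((incl W).obj a)).hom) =
          (G.map₂ ((incl W).mapId a).hom ≫ (G.mapId ((incl W).obj a)).hom) ▷
              component θ ((incl W).obj a) ≫ (λ_ (component θ ((incl W).obj a))).hom ≫
            (ρ_ (component θ ((incl W).obj a))).inv := θ.naturality_id a
      rw [whiskerLeft_comp, comp_whiskerRight] at h₁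
      rw [IsNatural, ← cancel_mono (component θ ((incl W).obj a) ◁ (H.mapId ((incl W).obj a)).hom)]
      simpa [naturalityId] using h₁.symm
    exact ⟨h, h.symm⟩
  | mapComp f g =>
    have h : IsNatural (naturalityOf θ (f ≫ g))
        (naturalityComp (naturalityOf θ f) (naturalityOf θ g)) ((incl W).mapComp f g).hom := by
      have h₁ : (naturalityOf θ (f ≫ g)).hom ≫ component θ ((incl W).obj _) ◁
          (H.map₂ ((incl W).mapComp f g).hom ≫ (H.mapComp ((incl W).map f) ((incl W).map g)).hom) =
          (G.map₂ ((incl W).mapComp f g).hom ≫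
            (G.mapComp ((incl W).map f) ((incl W).map g)).hom) ▷ component θ ((incl W).obj _) ≫
            (α_ _ _ _).hom ≫ G.map ((incl W).map f) ◁ (naturalityOf θ g).hom ≫
            (α_ _ _ _).inv ≫ (naturalityOf θ f).hom ▷ H.map ((incl W).map g) ≫
            (α_ _ _ _).hom := θ.naturality_comp f g
      rw [whiskerLeft_comp, comp_whiskerRight] at h₁
      rw [IsNatural, ← cancel_mono (component θ ((incl W).obj _) ◁
        (H.mapComp ((incl W).map f) ((incl W).map g)).hom)]
      simpa [naturalityComp] using h₁.symm
    exact ⟨h, h.symm⟩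
  | counit f hf => exact ⟨counit f hf, (counit f hf).symm⟩
  | @unit a b f hf =>
    -- By the triangle identity, naturality for the counit gives it for the unit whiskered with `f`.
    have h : IsNatural (naturalityId (component θ ((incl W).obj a)))
        (naturalityComp (naturalityOf θ f) (naturalityInv θ f hf))
        (formalInverse W f hf).unit.hom := by
      refine IsNatural.of_whiskerRight (inverts_incl f hf) (u := naturalityOf θ f) ?_
      have tri : (formalInverse W f hf).unit.hom ▷ (incl W).map f = (λ_ _).hom ≫ (ρ_ _).inv ≫
          (incl W).map f ◁ (formalInverse W f hf).counit.inv ≫ (α_ _ _ _).inv := by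
        rw [← cancel_mono (α_ _ _ _).hom,
          ← cancel_mono ((incl W).map f ◁ (formalInverse W f hf).counit.hom), Category.assoc,
          (formalInverse W f hf).triangle]
        simp
      rw [tri]
      exact (isNatural_leftUnitor _).comp ((isNatural_rightUnitor _).symm.comp
        ((isNatural_whiskerLeft _ (counit f hf).symm).comp (isNatural_associator _ _ _).symm))
    exact ⟨h, h.symm⟩

/-- The extension to the formal localisation of a transformation given on `K`. -/
noncomputable def extend : G ⟶ H where
  app a := component θ a
  naturality f := extendNaturality θ f
  naturality_naturality η := isNatural_extendNaturality θ η
  naturality_id a := by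
    change (naturalityId (component θ a)).hom ≫ _ = _
    simp [naturalityId]
  naturality_comp f g := by
    change (naturalityComp (extendNaturality θ f) (extendNaturality θ g)).hom ≫ _ = _
    simp [naturalityComp]

end Extend

instance essSurj_precomposition : ((precomposition (incl W) A).mapFunctor G H).EssSurj where
  mem_essImage θ := ⟨extend θ, ⟨Pseudofunctor.StrongTrans.isoMk
    (fun a => Iso.refl (θ.app a)) (fun f => whisker_id_comm (θ.naturality f).hom)⟩⟩

/-- The universal property of the formal localisation, for an arbitrary class `W` and test
bicategories in arbitrary universes. -/
theorem isLocalisation_incl : IsLocalisation.{wA, vA, uA} (incl W) W where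
  inverts := inverts_incl
  essSurj A _ F hF := by
    refine ⟨lift F fun a b f hf => (hF f hf).nonempty_adjointInverse.some, ⟨?_⟩⟩
    change (incl W).comp _ ≌ F
    rw [incl_comp_lift]
    exact Bicategory.Equivalence.id F
  locally_equivalence A _ G H := { }

end FormalLoc
end TwoSite

namespace TwoSite
/-! ### Representing 2-arrows by 2-arrows of the given bicategory -/

section Charts

variable {K M : Type*} [Bicategory K] [Bicategory M] {Q : K ⥤ᵖ M}

/-- If `κ` and `κ'` represent the restrictions of `T` and `T'` along `j` by arrows `b` and `b'` of
`K`, this says that the restriction of `α` along `j` corresponds to the 2-arrow `β` of `K`. -/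
def IsRepresentedBy {x y u : K} {j : u ⟶ x} {T T' : Q.obj x ⟶ Q.obj y} {b b' : u ⟶ y}
    (κ : Q.map j ≫ T ≅ Q.map b) (κ' : Q.map j ≫ T' ≅ Q.map b') (α : T ⟶ T') (β : b ⟶ b') :
    Prop :=
  Q.map j ◁ α ≫ κ'.hom = κ.hom ≫ Q.map₂ β

/-- If the restriction of `T` along `j` is represented by `b`, then the restriction along
`l ≅ s ≫ j` is represented by `s ≫ b`. -/
def restrictIso {x y u v : K} {j : u ⟶ x} {T : Q.obj x ⟶ Q.obj y} {b : u ⟶ y}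
    (κ : Q.map j ≫ T ≅ Q.map b) (s : v ⟶ u) {l : v ⟶ x} (σ : s ≫ j ≅ l) :
    Q.map l ≫ T ≅ Q.map (s ≫ b) :=
  whiskerRightIso (Q.map₂Iso σ.symm ≪≫ Q.mapComp s j) T ≪≫ α_ _ _ _ ≪≫
    whiskerLeftIso (Q.map s) κ ≪≫ (Q.mapComp s b).symm

theorem restrictIso_hom {x y u v : K} {j : u ⟶ x} {T : Q.obj x ⟶ Q.obj y} {b : u ⟶ y}
    (κ : Q.map j ≫ T ≅ Q.map b) (s : v ⟶ u) {l : v ⟶ x} (σ : s ≫ j ≅ l) :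
    (restrictIso κ s σ).hom = Q.map₂ σ.inv ▷ T ≫ (Q.mapComp s j).hom ▷ T ≫ (α_ _ _ _).hom ≫
      Q.map s ◁ κ.hom ≫ (Q.mapComp s b).inv := by
  simp only [restrictIso, Iso.trans_hom, whiskerRightIso_hom, PrelaxFunctor.map₂Iso_hom,
    Iso.symm_hom, comp_whiskerRight, whiskerLeftIso_hom, Category.assoc]

theorem map_comp_whiskerLeft {x y z : K} (t : x ⟶ y) (s : y ⟶ z) {m : M} {p p' : Q.obj z ⟶ m}
    (η : p ⟶ p') : Q.map (t ≫ s) ◁ η =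
      (Q.mapComp t s).hom ▷ p ≫ (α_ _ _ _).hom ≫ Q.map t ◁ Q.map s ◁ η ≫ (α_ _ _ _).inv ≫
        (Q.mapComp t s).inv ▷ p' := by
  have : Q.map (t ≫ s) ◁ η ≫ (Q.mapComp t s).hom ▷ p' =
      (Q.mapComp t s).hom ▷ p ≫ (Q.map t ≫ Q.map s) ◁ η := whisker_exchange _ _
  rw [← cancel_mono ((Q.mapComp t s).hom ▷ p'), this]
  simp

theorem map_id_whiskerLeft {x : K} {m : M} {p p' : Q.obj x ⟶ m} (η : p ⟶ p') :
    Q.map (𝟙 x) ◁ η = (Q.mapId x).hom ▷ p ≫ (λ_ p).hom ≫ η ≫ (λ_ p').inv ≫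
      (Q.mapId x).inv ▷ p' := by
  have : Q.map (𝟙 x) ◁ η ≫ (Q.mapId x).hom ▷ p' = (Q.mapId x).hom ▷ p ≫ 𝟙 _ ◁ η :=
    whisker_exchange _ _
  rw [← cancel_mono ((Q.mapId x).hom ▷ p'), this]
  simp

theorem map₂_associator_inv {a b c d : K} (f : a ⟶ b) (g : b ⟶ c) (h : c ⟶ d) :
    Q.map₂ (α_ f g h).inv = (Q.mapComp f (g ≫ h)).hom ≫ Q.map f ◁ (Q.mapComp g h).hom ≫
      (α_ _ _ _).inv ≫ (Q.mapComp f g).inv ▷ Q.map h ≫ (Q.mapComp (f ≫ g) h).inv := by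
  rw [← PrelaxFunctor.map₂Iso_inv, Iso.inv_ext (f := Q.map₂Iso _)]
  simp

theorem map₂_leftUnitor_inv {a b : K} (f : a ⟶ b) : Q.map₂ (λ_ f).inv =
    (λ_ (Q.map f)).inv ≫ (Q.mapId a).inv ▷ Q.map f ≫ (Q.mapComp (𝟙 a) f).inv := by
  rw [← PrelaxFunctor.map₂Iso_inv, Iso.inv_ext (f := Q.map₂Iso _)]
  simp

section
variable {x y u : K} {j : u ⟶ x} {T T' T'' : Q.obj x ⟶ Q.obj y} {b b' b'' : u ⟶ y}
  {κ : Q.map j ≫ T ≅ Q.map b} {κ' : Q.map j ≫ T' ≅ Q.map b'} {κ'' : Q.map j ≫ T'' ≅ Q.map b''}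
  {α : T ⟶ T'} {β : b ⟶ b'}

theorem IsRepresentedBy.comp {α' : T' ⟶ T''} {β' : b' ⟶ b''} (h : IsRepresentedBy κ κ' α β)
    (h' : IsRepresentedBy κ' κ'' α' β') : IsRepresentedBy κ κ'' (α ≫ α') (β ≫ β') := by
  unfold IsRepresentedBy at *
  simp [h', reassoc_of% h]

theorem IsRepresentedBy.symm {α : T ≅ T'} {β : b ≅ b'} (h : IsRepresentedBy κ κ' α.hom β.hom) :
    IsRepresentedBy κ' κ α.inv β.inv := by
  unfold IsRepresentedBy at *
  have : Q.map₂ β.hom ≫ Q.map₂ β.inv = 𝟙 _ := by simp [← PrelaxFunctor.map₂_comp]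
  rw [← Category.comp_id (_ ◁ _ ≫ _), ← this, Category.assoc, ← reassoc_of% h]
  simp

theorem IsRepresentedBy.restrict (h : IsRepresentedBy κ κ' α β) {v : K} (s : v ⟶ u) {l : v ⟶ x}
    (σ : s ≫ j ≅ l) :
    IsRepresentedBy (restrictIso κ s σ) (restrictIso κ' s σ) α (s ◁ β) := by
  unfold IsRepresentedBy at *
  have h₁ : Q.map s ◁ Q.map j ◁ α ≫ Q.map s ◁ κ'.hom =
      Q.map s ◁ κ.hom ≫ Q.map s ◁ Q.map₂ β := by
    rw [← whiskerLeft_comp, h, whiskerLeft_comp]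
  simp [restrictIso_hom, whisker_exchange_assoc, reassoc_of% h₁]

theorem isRepresentedBy_restrict_restrict (κ : Q.map j ≫ T ≅ Q.map b) {v w : K} (s : v ⟶ u)
    {l : v ⟶ x} (σ : s ≫ j ≅ l) (t : w ⟶ v) {m : w ⟶ x} (π : t ≫ l ≅ m) :
    IsRepresentedBy (restrictIso (restrictIso κ s σ) t π)
      (restrictIso κ (t ≫ s) (α_ t s j ≪≫ whiskerLeftIso t σ ≪≫ π)) (𝟙 T) (α_ t s b).inv := by
  simp [restrictIso_hom, IsRepresentedBy, map_comp_whiskerLeft, map₂_associator_inv]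

theorem isRepresentedBy_whiskerRight (κ : Q.map j ≫ T ≅ Q.map b) {v : K} {s s' : v ⟶ u}
    {l : v ⟶ x} (σ : s ≫ j ≅ l) (σ' : s' ≫ j ≅ l) (γ : s ⟶ s') (h : γ ▷ j ≫ σ'.hom = σ.hom) :
    IsRepresentedBy (restrictIso κ s σ) (restrictIso κ s' σ') (𝟙 T) (γ ▷ b) := by
  have h' : σ.inv ≫ γ ▷ j = σ'.inv := by simp [Iso.inv_comp_eq, ← h]
  simp [restrictIso_hom, IsRepresentedBy, ← h']
  rw [associator_naturality_left_assoc, ← whisker_exchange_assoc]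

theorem isRepresentedBy_restrict_id (κ : Q.map j ≫ T ≅ Q.map b) :
    IsRepresentedBy (restrictIso κ (𝟙 u) (λ_ j)) κ (𝟙 T) (λ_ b).hom := by
  simp [restrictIso_hom, IsRepresentedBy, map_id_whiskerLeft, map₂_leftUnitor_inv]

end

/-- If the restriction of `T` along `j` is represented by `b`, then a square `h ≫ j ≅ k ≫ f` gives a
representation of the restriction of `Q f ≫ T` along `k` by `h ≫ b`. -/
def pullIso {x' x y u v : K} {j : u ⟶ x} {T : Q.obj x ⟶ Q.obj y} {b : u ⟶ y}
    (κ : Q.map j ≫ T ≅ Q.map b) (f : x' ⟶ x) (k : v ⟶ x') (h : v ⟶ u) (φ : h ≫ j ≅ k ≫ f) :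
    Q.map k ≫ Q.map f ≫ T ≅ Q.map (h ≫ b) :=
  (α_ _ _ _).symm ≪≫ whiskerRightIso (Q.mapComp k f).symm T ≪≫ restrictIso κ h φ

theorem pullIso_hom {x' x y u v : K} {j : u ⟶ x} {T : Q.obj x ⟶ Q.obj y} {b : u ⟶ y}
    (κ : Q.map j ≫ T ≅ Q.map b) (f : x' ⟶ x) (k : v ⟶ x') (h : v ⟶ u) (φ : h ≫ j ≅ k ≫ f) :
    (pullIso κ f k h φ).hom = (α_ _ _ _).inv ≫ (Q.mapComp k f).inv ▷ T ≫
      (restrictIso κ h φ).hom := by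
  simp [pullIso]

section
variable {x' x y u v w : K} {j : u ⟶ x} {T T' : Q.obj x ⟶ Q.obj y} {b b' : u ⟶ y}
  {κ : Q.map j ≫ T ≅ Q.map b} {κ' : Q.map j ≫ T' ≅ Q.map b'}
  {α : T ⟶ T'} {β : b ⟶ b'}

theorem IsRepresentedBy.pull (H : IsRepresentedBy κ κ' α β) (f : x' ⟶ x) (k : v ⟶ x') (h : v ⟶ u)
    (φ : h ≫ j ≅ k ≫ f) :
    IsRepresentedBy (pullIso κ f k h φ) (pullIso κ' f k h φ) (Q.map f ◁ α) (h ◁ β) := by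
  have := H.restrict h φ
  unfold IsRepresentedBy at *
  rw [pullIso_hom, pullIso_hom, Category.assoc, Category.assoc, ← this]
  rw [associator_inv_naturality_right_assoc, whisker_exchange_assoc]

theorem isRepresentedBy_restrict_pull (κ : Q.map j ≫ T ≅ Q.map b) (f : x' ⟶ x) (k : v ⟶ x')
    (h : v ⟶ u) (φ : h ≫ j ≅ k ≫ f) (t : w ⟶ v) {m : w ⟶ x'} (π : t ≫ k ≅ m) :
    IsRepresentedBy (restrictIso (pullIso κ f k h φ) t π)
      (pullIso κ f m (t ≫ h) (α_ t h j ≪≫ whiskerLeftIso t φ ≪≫ (α_ t k f).symm ≪≫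
        whiskerRightIso π f)) (𝟙 _) (α_ t h b).inv := by
  simp [pullIso_hom, restrictIso_hom, IsRepresentedBy, map_comp_whiskerLeft, map₂_associator_inv]

theorem isRepresentedBy_pull_restrict (κ : Q.map j ≫ T ≅ Q.map b) (f : x' ⟶ x) (s : v ⟶ u)
    {l : v ⟶ x} (σ : s ≫ j ≅ l) (k : w ⟶ x') (h : w ⟶ v) (φ : h ≫ l ≅ k ≫ f) :
    IsRepresentedBy (pullIso (restrictIso κ s σ) f k h φ)
      (pullIso κ f k (h ≫ s) (α_ h s j ≪≫ whiskerLeftIso h σ ≪≫ φ)) (𝟙 _) (α_ h s b).inv := by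
  have := isRepresentedBy_restrict_restrict κ s σ h φ
  unfold IsRepresentedBy at *
  rw [pullIso_hom, pullIso_hom, Category.assoc, Category.assoc, ← this]
  simp

theorem isRepresentedBy_pull_whiskerRight (κ : Q.map j ≫ T ≅ Q.map b) {f g : x' ⟶ x} (η : f ⟶ g)
    (k : v ⟶ x') {h h' : v ⟶ u} (φ : h ≫ j ≅ k ≫ f) (φ' : h' ≫ j ≅ k ≫ g) (γ : h ⟶ h')
    (H : γ ▷ j ≫ φ'.hom = φ.hom ≫ k ◁ η) :
    IsRepresentedBy (pullIso κ f k h φ) (pullIso κ g k h' φ') (Q.map₂ η ▷ T) (γ ▷ b) := by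
  have H' : φ.inv ≫ γ ▷ j = k ◁ η ≫ φ'.inv := by simp [Iso.inv_comp_eq, ← reassoc_of% H]
  simp [pullIso_hom, restrictIso_hom, IsRepresentedBy]
  have h₁ : Q.map k ◁ Q.map₂ η ▷ T ≫ (α_ (Q.map k) (Q.map g) T).inv ≫ (Q.mapComp k g).inv ▷ T =
      (α_ _ _ _).inv ≫ (Q.mapComp k f).inv ▷ T ≫ Q.map₂ (k ◁ η) ▷ T := by
    rw [associator_inv_naturality_middle_assoc, ← comp_whiskerRight, ← comp_whiskerRight]
    simp
  have h₂ : Q.map₂ (k ◁ η) ▷ T ≫ Q.map₂ φ'.inv ▷ T =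
      Q.map₂ φ.inv ▷ T ≫ Q.map₂ (γ ▷ j) ▷ T := by
    rw [← comp_whiskerRight, ← PrelaxFunctor.map₂_comp, ← H', PrelaxFunctor.map₂_comp,
      comp_whiskerRight]
  rw [reassoc_of% h₁, reassoc_of% h₂]
  simp only [Pseudofunctor.map₂_whisker_right, comp_whiskerRight, Category.assoc,
    inv_hom_whiskerRight_assoc]
  rw [associator_naturality_left_assoc, ← whisker_exchange_assoc]

theorem isRepresentedBy_pull_id (κ : Q.map j ≫ T ≅ Q.map b) :
    IsRepresentedBy (pullIso κ (𝟙 x) j (𝟙 u) (λ_ j ≪≫ (ρ_ j).symm)) κ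
      ((Q.mapId x).hom ▷ T ≫ (λ_ T).hom) (λ_ b).hom := by
  simp [pullIso_hom, restrictIso_hom, IsRepresentedBy, map_id_whiskerLeft, map₂_leftUnitor_inv]

theorem isRepresentedBy_pull_comp {x'' : K} (κ : Q.map j ≫ T ≅ Q.map b) (f : x'' ⟶ x')
    (g : x' ⟶ x) (k : v ⟶ x') (h : v ⟶ u) (φ : h ≫ j ≅ k ≫ g) (k' : w ⟶ x'') (h' : w ⟶ v)
    (φ' : h' ≫ k ≅ k' ≫ f) :
    IsRepresentedBy (pullIso κ (f ≫ g) k' (h' ≫ h) (α_ _ _ _ ≪≫ whiskerLeftIso h' φ ≪≫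
        (α_ _ _ _).symm ≪≫ whiskerRightIso φ' g ≪≫ α_ _ _ _))
      (pullIso (pullIso κ g k h φ) f k' h' φ') ((Q.mapComp f g).hom ▷ T ≫ (α_ _ _ _).hom)
      (α_ h' h b).hom := by
  simp [pullIso_hom, restrictIso_hom, IsRepresentedBy, map_comp_whiskerLeft, map₂_associator_inv]

end

/-- If the restriction of `T` along `j` is represented by `b`, then so is the restriction of
`q⁻¹ ≫ T` along `j ≫ q`, for an inverse `q⁻¹` of `Q q`. -/
def pushIso {x x' y u : K} {j : u ⟶ x} {T : Q.obj x ⟶ Q.obj y} {b : u ⟶ y}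
    (κ : Q.map j ≫ T ≅ Q.map b) {q : x ⟶ x'} (e : AdjointInverse (Q.map q)) :
    Q.map (j ≫ q) ≫ e.inv ≫ T ≅ Q.map b :=
  whiskerRightIso (Q.mapComp j q) _ ≪≫ α_ _ _ _ ≪≫ whiskerLeftIso (Q.map j)
    ((α_ _ _ _).symm ≪≫ whiskerRightIso e.unit.symm T ≪≫ λ_ T) ≪≫ κ

/-- The cancellation of an arrow against its pseudo-inverse. -/
def AdjointInverse.cancel {a b c : M} {f : a ⟶ b} (e : AdjointInverse f) (T : a ⟶ c) :
    f ≫ e.inv ≫ T ≅ T :=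
  (α_ _ _ _).symm ≪≫ whiskerRightIso e.unit.symm T ≪≫ λ_ T

theorem pushIso_hom {x x' y u : K} {j : u ⟶ x} {T : Q.obj x ⟶ Q.obj y} {b : u ⟶ y}
    (κ : Q.map j ≫ T ≅ Q.map b) {q : x ⟶ x'} (e : AdjointInverse (Q.map q)) :
    (pushIso κ e).hom = (Q.mapComp j q).hom ▷ _ ≫ (α_ _ _ _).hom ≫
      Q.map j ◁ (e.cancel T).hom ≫ κ.hom := by
  simp [pushIso, AdjointInverse.cancel]

theorem AdjointInverse.cancel_naturality {a b c : M} {f : a ⟶ b} (e : AdjointInverse f)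
    {T T' : a ⟶ c} (α : T ⟶ T') :
    f ◁ e.inv ◁ α ≫ (e.cancel T').hom = (e.cancel T).hom ≫ α := by
  simp only [cancel, Iso.trans_hom, Iso.symm_hom, whiskerRightIso_hom, Category.assoc]
  rw [associator_inv_naturality_right_assoc, whisker_exchange_assoc]
  simp

/-- By the triangle identity, cancelling `f` against its inverse by means of the unit is the same as
cancelling by means of the counit. -/
theorem AdjointInverse.cancel_comp {a b c : M} {f : a ⟶ b} (e : AdjointInverse f) (T : b ⟶ c) :
    (e.cancel (f ≫ T)).hom = f ◁ ((α_ _ _ _).inv ≫ e.counit.hom ▷ T ≫ (λ_ T).hom) := by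
  have h : f ◁ e.counit.hom = (α_ _ _ _).inv ≫ e.unit.inv ▷ f ≫ (λ_ f).hom ≫ (ρ_ f).inv := by
    rw [← e.triangle]
    simp
  have h' : f ◁ e.counit.hom ▷ T = (α_ _ _ _).inv ≫ (f ◁ e.counit.hom) ▷ T ≫ (α_ _ _ _).hom := by
    simp
  rw [whiskerLeft_comp, whiskerLeft_comp, h', h]
  simp [cancel]

section
variable {x' x y u v w : K} {j : u ⟶ x} {T T' : Q.obj x ⟶ Q.obj y} {b b' : u ⟶ y}
  {κ : Q.map j ≫ T ≅ Q.map b} {κ' : Q.map j ≫ T' ≅ Q.map b'}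
  {α : T ⟶ T'} {β : b ⟶ b'} {q : x ⟶ x'}

theorem IsRepresentedBy.push (H : IsRepresentedBy κ κ' α β) (e : AdjointInverse (Q.map q)) :
    IsRepresentedBy (pushIso κ e) (pushIso κ' e) (e.inv ◁ α) β := by
  unfold IsRepresentedBy at *
  have h : Q.map j ◁ Q.map q ◁ e.inv ◁ α ≫ Q.map j ◁ (e.cancel T').hom =
      Q.map j ◁ (e.cancel T).hom ≫ Q.map j ◁ α := by
    rw [← whiskerLeft_comp, e.cancel_naturality, whiskerLeft_comp]
  simp only [pushIso_hom, Category.assoc, ← H]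
  rw [← reassoc_of% h]
  simp [map_comp_whiskerLeft]

theorem isRepresentedBy_restrict_push (κ : Q.map j ≫ T ≅ Q.map b) (e : AdjointInverse (Q.map q))
    (s : v ⟶ u) {l : v ⟶ x} (σ : s ≫ j ≅ l) :
    IsRepresentedBy (restrictIso (pushIso κ e) s ((α_ s j q).symm ≪≫ whiskerRightIso σ q))
      (pushIso (restrictIso κ s σ) e) (𝟙 _) (𝟙 _) := by
  have h : Q.map l ◁ (e.cancel T).hom ≫ Q.map₂ σ.inv ▷ T =
      Q.map₂ σ.inv ▷ _ ≫ Q.map (s ≫ j) ◁ (e.cancel T).hom := whisker_exchange _ _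
  simp only [pushIso_hom, restrictIso_hom, IsRepresentedBy, Category.assoc, reassoc_of% h]
  simp [map_comp_whiskerLeft]
  bicategory

theorem isRepresentedBy_pull_push (κ : Q.map j ≫ T ≅ Q.map b) (e : AdjointInverse (Q.map q)) :
    IsRepresentedBy κ (pullIso (pushIso κ e) q j (𝟙 u) (λ_ _)) (e.cancel T).inv (λ_ b).inv := by
  simp [pushIso_hom, pullIso_hom, restrictIso_hom, IsRepresentedBy, map_id_whiskerLeft,
    map₂_leftUnitor_inv]

theorem isRepresentedBy_push_pull {q : x' ⟶ x} (κ : Q.map j ≫ T ≅ Q.map b)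
    (e : AdjointInverse (Q.map q)) (k : v ⟶ x') (h : v ⟶ u) (φ : h ≫ j ≅ k ≫ q) :
    IsRepresentedBy (pushIso (pullIso κ q k h φ) e) (restrictIso κ h φ)
      ((α_ _ _ _).inv ≫ e.counit.hom ▷ T ≫ (λ_ T).hom) (𝟙 _) := by
  rw [IsRepresentedBy, map_comp_whiskerLeft, ← e.cancel_comp, pushIso_hom, pullIso_hom]
  simp

end

end Charts
end TwoSite

namespace TwoSite

/-! ### Charts and locally representable 2-arrows -/

section Charts

variable {K M : Type*} [Bicategory K] [Bicategory M] {Q : K ⥤ᵖ M} {J : MorphismProperty K}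

theorem IsFF.exists_iso {u x v : K} {q : u ⟶ x} (hq : IsFF q) {s t : v ⟶ u}
    (i : s ≫ q ≅ t ≫ q) : ∃ γ : s ≅ t, γ.hom ▷ q = i.hom := by
  obtain ⟨_, _⟩ := hq v
  exact ⟨(postcomp v q).preimageIso i, (postcomp v q).map_preimage i.hom⟩

theorem IsFF.exists_hom {u x v : K} {q : u ⟶ x} (hq : IsFF q) {s t : v ⟶ u}
    (i : s ≫ q ⟶ t ≫ q) : ∃ γ : s ⟶ t, γ ▷ q = i := by
  obtain ⟨_, _⟩ := hq v
  exact (postcomp v q).map_surjective i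

/-- A chart of a 1-arrow `T : Q x ⟶ Q y`: an arrow `cover : u ⟶ x` in `J` such that the restriction
of `T` along it is represented by an arrow `u ⟶ y` of `K`. -/
structure Chart (J : MorphismProperty K) {x y : K} (T : Q.obj x ⟶ Q.obj y) where
  /-- The domain of the chart. -/
  dom : K
  /-- The arrow in `J` along which `T` is restricted. -/
  cover : dom ⟶ x
  mem : J cover
  /-- The arrow of `K` that represents the restriction of `T`. -/
  rep : dom ⟶ y
  /-- The 2-arrow exhibiting the representation. -/
  iso : Q.map cover ≫ T ≅ Q.map rep

/-- The 2-arrow `α` is represented, in the charts `c` and `d`, by a 2-arrow of `K` after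
restriction along `l`. -/
def IsRepresentableOn {x y : K} {T T' : Q.obj x ⟶ Q.obj y} (c : Chart J T) (d : Chart J T')
    (α : T ⟶ T') {v : K} (l : v ⟶ x) : Prop :=
  ∃ (s : v ⟶ c.dom) (σ : s ≫ c.cover ≅ l) (t : v ⟶ d.dom) (τ : t ≫ d.cover ≅ l)
    (β : s ≫ c.rep ⟶ t ≫ d.rep),
    IsRepresentedBy (restrictIso c.iso s σ) (restrictIso d.iso t τ) α β

/-- The 2-arrow `α` is, in the charts `c` and `d`, locally represented by 2-arrows of `K`. -/
def IsLocallyRepresentable {x y : K} {T T' : Q.obj x ⟶ Q.obj y} (c : Chart J T) (d : Chart J T')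
    (α : T ⟶ T') : Prop :=
  ∃ (v : K) (l : v ⟶ x), J l ∧ IsRepresentableOn c d α l

section

variable {x y : K} {T T' T'' : Q.obj x ⟶ Q.obj y} {c : Chart J T} {d : Chart J T'}
  {e : Chart J T''} {α : T ⟶ T'} {α' : T' ⟶ T''}

/-- Representability along `l` does not depend on how `l` is factored through the covers, because
the covers are ff. -/
theorem IsRepresentableOn.exists_isRepresentedBy (hJ : IsFFSingletonCoverage J) {v : K}
    {l : v ⟶ x} (h : IsRepresentableOn c d α l)
    (s : v ⟶ c.dom) (σ : s ≫ c.cover ≅ l) (t : v ⟶ d.dom) (τ : t ≫ d.cover ≅ l) :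
    ∃ β : s ≫ c.rep ⟶ t ≫ d.rep,
      IsRepresentedBy (restrictIso c.iso s σ) (restrictIso d.iso t τ) α β := by
  obtain ⟨s', σ', t', τ', β, hβ⟩ := h
  obtain ⟨γ, hγ⟩ := (hJ.ff _ c.mem).exists_iso (σ ≪≫ σ'.symm)
  obtain ⟨δ, hδ⟩ := (hJ.ff _ d.mem).exists_iso (τ' ≪≫ τ.symm)
  have h₁ := isRepresentedBy_whiskerRight c.iso σ σ' γ.hom (by simp [hγ])
  have h₂ := isRepresentedBy_whiskerRight d.iso τ' τ δ.hom (by simp [hδ])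
  exact ⟨_, by simpa using (h₁.comp hβ).comp h₂⟩

theorem IsRepresentableOn.refine {v w : K} {l : v ⟶ x} (h : IsRepresentableOn c d α l)
    (t : w ⟶ v) {m : w ⟶ x} (π : t ≫ l ≅ m) : IsRepresentableOn c d α m := by
  obtain ⟨s, σ, s', σ', β, hβ⟩ := h
  have h₁ := (isRepresentedBy_restrict_restrict c.iso s σ t π).symm (α := Iso.refl _)
    (β := (α_ _ _ _).symm)
  have h₂ := isRepresentedBy_restrict_restrict d.iso s' σ' t π
  exact ⟨_, _, _, _, _, by simpa using (h₁.comp (hβ.restrict t π)).comp h₂⟩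

theorem IsLocallyRepresentable.comp (hJ : IsFFSingletonCoverage J)
    (h : IsLocallyRepresentable c d α) (h' : IsLocallyRepresentable d e α') :
    IsLocallyRepresentable c e (α ≫ α') := by
  obtain ⟨v, l, hl, h⟩ := h
  obtain ⟨v', l', hl', h'⟩ := h'
  obtain ⟨w, k, g, hk, ⟨φ⟩⟩ := hJ.exists_square l' l hl'
  -- Both 2-arrows are restricted along a common refinement of `l` and `l'`.
  refine ⟨w, k ≫ l, hJ.comp_mem _ _ hk hl, ?_⟩
  obtain ⟨s, σ, t, τ, β, hβ⟩ := h.refine k (Iso.refl _)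
  obtain ⟨r, ρ, hr⟩ : ∃ (r : w ⟶ e.dom) (ρ : r ≫ e.cover ≅ k ≫ l), True := by
    obtain ⟨_, _, r, ρ, -⟩ := h'.refine g φ
    exact ⟨r, ρ, trivial⟩
  obtain ⟨β', hβ'⟩ := (h'.refine g φ).exists_isRepresentedBy hJ t τ r ρ
  exact ⟨s, σ, r, ρ, _, hβ.comp hβ'⟩

theorem isLocallyRepresentable_of_isRepresentedBy {u : K} {j : u ⟶ x} (hj : J j)
    {b b' : u ⟶ y} {κ : Q.map j ≫ T ≅ Q.map b} {κ' : Q.map j ≫ T' ≅ Q.map b'} {β : b ⟶ b'}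
    (h : IsRepresentedBy κ κ' α β) :
    IsLocallyRepresentable (⟨u, j, hj, b, κ⟩ : Chart J T) (⟨u, j, hj, b', κ'⟩ : Chart J T') α :=
  ⟨u, j, hj, 𝟙 u, λ_ j, 𝟙 u, λ_ j, _, h.restrict _ _⟩

variable (c) in
theorem isLocallyRepresentable_id : IsLocallyRepresentable c c (𝟙 T) :=
  isLocallyRepresentable_of_isRepresentedBy c.mem (β := 𝟙 _) (by simp [IsRepresentedBy])

theorem isLocallyRepresentable_iso_of_isRepresentedBy {u : K} {j : u ⟶ x} (hj : J j)
    {b b' : u ⟶ y} {κ : Q.map j ≫ T ≅ Q.map b} {κ' : Q.map j ≫ T' ≅ Q.map b'} (α : T ≅ T')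
    (β : b ≅ b') (h : IsRepresentedBy κ κ' α.hom β.hom) :
    IsLocallyRepresentable (⟨u, j, hj, b, κ⟩ : Chart J T) (⟨u, j, hj, b', κ'⟩ : Chart J T')
        α.hom ∧
      IsLocallyRepresentable (⟨u, j, hj, b', κ'⟩ : Chart J T') (⟨u, j, hj, b, κ⟩ : Chart J T)
        α.inv :=
  ⟨isLocallyRepresentable_of_isRepresentedBy hj h,
    isLocallyRepresentable_of_isRepresentedBy hj h.symm⟩

/-- Restriction of a chart along a refinement of its cover. -/
def Chart.restrict (c : Chart J T) {v : K} (s : v ⟶ c.dom) {l : v ⟶ x}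
    (σ : s ≫ c.cover ≅ l) (hl : J l) : Chart J T :=
  ⟨v, l, hl, s ≫ c.rep, restrictIso c.iso s σ⟩

theorem isLocallyRepresentable_restrict (c : Chart J T) {v : K} (s : v ⟶ c.dom) {l : v ⟶ x}
    (σ : s ≫ c.cover ≅ l) (hl : J l) :
    IsLocallyRepresentable c (c.restrict s σ hl) (𝟙 T) ∧
      IsLocallyRepresentable (c.restrict s σ hl) c (𝟙 T) := by
  have h := isRepresentedBy_restrict_id (restrictIso c.iso s σ)
  exact ⟨⟨v, l, hl, s, σ, 𝟙 v, λ_ l, _, h.symm (α := Iso.refl _)⟩,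
    ⟨v, l, hl, 𝟙 v, λ_ l, s, σ, _, h⟩⟩

/-- Transport of a chart along an invertible 2-arrow. -/
def Chart.congr (c : Chart J T) (i : T ≅ T') : Chart J T' :=
  ⟨c.dom, c.cover, c.mem, c.rep, whiskerLeftIso (Q.map c.cover) i.symm ≪≫ c.iso⟩

theorem isLocallyRepresentable_congr (c : Chart J T) (i : T ≅ T') :
    IsLocallyRepresentable c (c.congr i) i.hom ∧ IsLocallyRepresentable (c.congr i) c i.inv :=
  isLocallyRepresentable_iso_of_isRepresentedBy c.mem i (Iso.refl _) (by simp [IsRepresentedBy])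

end

section Pull

variable {x' x y : K} {T T' : Q.obj x ⟶ Q.obj y}

/-- The pullback of a chart along an arrow of `K`, by means of a square. -/
def Chart.pull (c : Chart J T) (f : x' ⟶ x) {v : K} (k : v ⟶ x') (hk : J k)
    (h : v ⟶ c.dom) (φ : h ≫ c.cover ≅ k ≫ f) : Chart J (Q.map f ≫ T) :=
  ⟨v, k, hk, h ≫ c.rep, pullIso c.iso f k h φ⟩

/-- The pullback of a chart along an arrow of `K`, by means of some square. -/
noncomputable def Chart.pullback (hJ : IsFFSingletonCoverage J) (c : Chart J T) (f : x' ⟶ x) :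
    Chart J (Q.map f ≫ T) :=
  have h := (hJ.exists_square c.cover f c.mem).choose_spec.choose_spec.choose_spec
  c.pull f _ h.1 _ h.2.some

theorem Chart.exists_pullback_eq (hJ : IsFFSingletonCoverage J) (c : Chart J T) (f : x' ⟶ x) :
    ∃ (v : K) (k : v ⟶ x') (hk : J k) (h : v ⟶ c.dom) (φ : h ≫ c.cover ≅ k ≫ f),
      c.pullback hJ f = c.pull f k hk h φ :=
  ⟨_, _, _, _, _, rfl⟩

/-- Pullbacks of a chart by means of different squares are compatible, also along a 2-arrow of
`K`. -/
theorem isLocallyRepresentable_pull (hJ : IsFFSingletonCoverage J) (c : Chart J T)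
    {f g : x' ⟶ x} (η : f ⟶ g) {v v' : K} (k : v ⟶ x') (hk : J k) (h : v ⟶ c.dom)
    (φ : h ≫ c.cover ≅ k ≫ f) (k' : v' ⟶ x') (hk' : J k') (h' : v' ⟶ c.dom)
    (φ' : h' ≫ c.cover ≅ k' ≫ g) :
    IsLocallyRepresentable (c.pull f k hk h φ) (c.pull g k' hk' h' φ') (Q.map₂ η ▷ T) := by
  obtain ⟨w, t, t', ht, ⟨ψ⟩⟩ := hJ.exists_square k' k hk'
  have h₁ := isRepresentedBy_restrict_pull c.iso f k h φ t (Iso.refl (t ≫ k))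
  have h₂ := (isRepresentedBy_restrict_pull c.iso g k' h' φ' t' ψ).symm
    (α := Iso.refl _) (β := (α_ _ _ _).symm)
  generalize α_ t h c.cover ≪≫ _ = χ at h₁
  generalize α_ t' h' c.cover ≪≫ _ = χ' at h₂
  -- The cover of `c` is ff, hence `η` lifts to the domain of `c`.
  obtain ⟨γ, hγ⟩ := (hJ.ff _ c.mem).exists_hom (χ.hom ≫ (t ≫ k) ◁ η ≫ χ'.inv)
  have h₃ := isRepresentedBy_pull_whiskerRight c.iso η (t ≫ k) χ χ' γ (by simp [hγ])
  have h₄ := h₁.comp (h₃.comp h₂)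
  simp only [Iso.refl_inv, Category.id_comp, Category.comp_id] at h₄
  exact ⟨w, t ≫ k, hJ.comp_mem _ _ ht hk, t, Iso.refl _, t', ψ, _, h₄⟩

theorem isLocallyRepresentable_pull_pullback (hJ : IsFFSingletonCoverage J) (c : Chart J T)
    (f : x' ⟶ x) {v : K} (k : v ⟶ x') (hk : J k) (h : v ⟶ c.dom)
    (φ : h ≫ c.cover ≅ k ≫ f) :
    IsLocallyRepresentable (c.pull f k hk h φ) (c.pullback hJ f) (𝟙 _) ∧
      IsLocallyRepresentable (c.pullback hJ f) (c.pull f k hk h φ) (𝟙 _) := by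
  have h : Q.map₂ (𝟙 f) ▷ T = 𝟙 _ := by simp
  rw [← h]
  exact ⟨isLocallyRepresentable_pull hJ c (𝟙 f) _ _ _ _ _ _ _ _,
    isLocallyRepresentable_pull hJ c (𝟙 f) _ _ _ _ _ _ _ _⟩

theorem IsLocallyRepresentable.pullback (hJ : IsFFSingletonCoverage J) {c : Chart J T}
    {d : Chart J T'} {α : T ⟶ T'} (H : IsLocallyRepresentable c d α) (f : x' ⟶ x) :
    IsLocallyRepresentable (c.pullback hJ f) (d.pullback hJ f) (Q.map f ◁ α) := by
  obtain ⟨v, l, hl, s, σ, t, τ, β, hβ⟩ := H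
  obtain ⟨w, k, h, hk, ⟨φ⟩⟩ := hJ.exists_square l f hl
  have h₁ := (isLocallyRepresentable_pull_pullback hJ c f k hk (h ≫ s)
    (α_ h s c.cover ≪≫ whiskerLeftIso h σ ≪≫ φ)).2
  have h₂ := (isLocallyRepresentable_iso_of_isRepresentedBy hk (Iso.refl _) (α_ _ _ _).symm
    (isRepresentedBy_pull_restrict c.iso f s σ k h φ)).2
  have h₃ := isLocallyRepresentable_of_isRepresentedBy hk (hβ.pull f k h φ)
  have h₄ := isLocallyRepresentable_of_isRepresentedBy hk
    (isRepresentedBy_pull_restrict d.iso f t τ k h φ)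
  have h₅ := (isLocallyRepresentable_pull_pullback hJ d f k hk (h ≫ t)
    (α_ h t d.cover ≪≫ whiskerLeftIso h τ ≪≫ φ)).1
  simpa using h₁.comp hJ (h₂.comp hJ (h₃.comp hJ (h₄.comp hJ h₅)))

end Pull

section Push

variable {x' x y : K} {T T' : Q.obj x ⟶ Q.obj y} {q : x ⟶ x'}

/-- The chart of the composite with an inverse of an arrow in `J`: the cover is composed with that
arrow. -/
def Chart.push (hJ : IsFFSingletonCoverage J) (c : Chart J T) (hq : J q)
    (e : AdjointInverse (Q.map q)) : Chart J (e.inv ≫ T) :=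
  ⟨c.dom, c.cover ≫ q, hJ.comp_mem _ _ c.mem hq, c.rep, pushIso c.iso e⟩

theorem IsLocallyRepresentable.push (hJ : IsFFSingletonCoverage J) {c : Chart J T}
    {d : Chart J T'} {α : T ⟶ T'} (H : IsLocallyRepresentable c d α) (hq : J q)
    (e : AdjointInverse (Q.map q)) :
    IsLocallyRepresentable (c.push hJ hq e) (d.push hJ hq e) (e.inv ◁ α) := by
  obtain ⟨v, l, hl, s, σ, t, τ, β, hβ⟩ := H
  have h₁ := isRepresentedBy_restrict_push c.iso e s σ
  have h₂ := (isRepresentedBy_restrict_push d.iso e t τ).symm (α := Iso.refl _) (β := Iso.refl _)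
  have h := h₁.comp ((hβ.push e).comp h₂)
  simp only [Iso.refl_inv, Category.id_comp, Category.comp_id] at h
  exact ⟨v, l ≫ q, hJ.comp_mem _ _ hl hq, s, _, t, _, β, h⟩

end Push

end Charts
end TwoSite

namespace TwoSite
namespace FormalLoc
variable {K : Type u} [Bicategory.{w, v} K] {J : MorphismProperty K}

/-! ### Representability of the 2-arrows of the formal localisation -/

/-- The chart of `S ≫ T` obtained from a chart of `T`, by recursion on the word `S`. -/
noncomputable def chartWord (hJ : IsFFSingletonCoverage J) : ∀ {a b : K} (S : Word J a b) {y : K}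
    {T : (incl J).obj b ⟶ (incl J).obj y}, Chart J T →
      Chart J (CategoryStruct.comp (X := (incl J).obj a) (Y := (incl J).obj b) S T)
  | _, _, .of f, _, _, c => c.pullback hJ f
  | _, _, .inv f hf, _, _, c => c.push hJ hf (formalInverse J f hf)
  | _, _, .id _, _, T, c => c.congr (λ_ T).symm
  | a, b, .comp (b := d) f g, _, T, c => (chartWord hJ f (chartWord hJ g c)).congr
      (associator (B := FormalLoc J) (show (incl J).obj a ⟶ (incl J).obj d from f)
        (show (incl J).obj d ⟶ (incl J).obj b from g) T).symm

theorem _root_.TwoSite.IsLocallyRepresentable.of_eq {x y : K}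
    {T T' : (incl J).obj x ⟶ (incl J).obj y} {c : Chart J T} {d : Chart J T'} {α α' : T ⟶ T'}
    (h : IsLocallyRepresentable c d α)
    (e : α = α') : IsLocallyRepresentable c d α' :=
  e ▸ h

variable (hJ : IsFFSingletonCoverage J)

/-- The chart of `S ≫ T` obtained from a chart of `T`, for a 1-arrow `S` of the formal
localisation. -/
noncomputable def chartComp {a b : K} (S : (incl J).obj a ⟶ (incl J).obj b) {y : K}
    {T : (incl J).obj b ⟶ (incl J).obj y} (c : Chart J T) : Chart J (S ≫ T) :=
  chartWord hJ S c

theorem isLocallyRepresentable_chartComp {a b : K} (S : (incl J).obj a ⟶ (incl J).obj b)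
    {y : K} {T T' : (incl J).obj b ⟶ (incl J).obj y} {c : Chart J T} {d : Chart J T'}
    {α : T ⟶ T'} (h : IsLocallyRepresentable c d α) :
    IsLocallyRepresentable (chartComp hJ S c) (chartComp hJ S d) (S ◁ α) := by
  induction S using hom_induction generalizing y with
  | of f => exact h.pullback hJ f
  | inv f hf => exact h.push hJ hf (formalInverse J f hf)
  | id a =>
    have := (isLocallyRepresentable_congr c (λ_ T).symm).2.comp hJ
      (h.comp hJ (isLocallyRepresentable_congr d (λ_ T').symm).1)
    rw [id_whiskerLeft]
    exact this
  | comp f g hf hg =>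
    have := (isLocallyRepresentable_congr (chartComp hJ f (chartComp hJ g c))
      (α_ f g T).symm).2.comp hJ ((hf (hg h)).comp hJ (isLocallyRepresentable_congr
        (chartComp hJ f (chartComp hJ g d)) (α_ f g T').symm).1)
    rw [comp_whiskerLeft]
    exact this

/-- A form of `IsLocallyRepresentable.comp` for invertible 2-arrows. -/
theorem isLocallyRepresentable_trans (hJ : IsFFSingletonCoverage J) {x y : K}
    {T T' T'' : (incl J).obj x ⟶ (incl J).obj y} {c : Chart J T} {d : Chart J T'}
    {e : Chart J T''} {α : T ≅ T'} {β : T' ≅ T''}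
    (h : IsLocallyRepresentable c d α.hom ∧ IsLocallyRepresentable d c α.inv)
    (h' : IsLocallyRepresentable d e β.hom ∧ IsLocallyRepresentable e d β.inv) :
    IsLocallyRepresentable c e (α ≪≫ β).hom ∧ IsLocallyRepresentable e c (α ≪≫ β).inv :=
  ⟨h.1.comp hJ h'.1, h'.2.comp hJ h.2⟩

theorem isLocallyRepresentable_mapId {a y : K} {T : (incl J).obj a ⟶ (incl J).obj y}
    (c : Chart J T) :
    IsLocallyRepresentable (c.pullback hJ (𝟙 a)) c
        (whiskerRightIso ((incl J).mapId a) T ≪≫ λ_ T).hom ∧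
      IsLocallyRepresentable c (c.pullback hJ (𝟙 a))
        (whiskerRightIso ((incl J).mapId a) T ≪≫ λ_ T).inv := by
  have h₁ := isLocallyRepresentable_iso_of_isRepresentedBy c.mem
    (whiskerRightIso ((incl J).mapId a) T ≪≫ λ_ T) (λ_ c.rep)
    (isRepresentedBy_pull_id c.iso)
  have h₂ := isLocallyRepresentable_pull_pullback hJ c (𝟙 a) c.cover c.mem (𝟙 _)
    (λ_ _ ≪≫ (ρ_ _).symm)
  exact ⟨(h₂.2.comp hJ h₁.1).of_eq (Category.id_comp _),
    (h₁.2.comp hJ h₂.1).of_eq (Category.comp_id _)⟩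

theorem isLocallyRepresentable_mapComp {a b c y : K} (f : a ⟶ b) (g : b ⟶ c)
    {T : (incl J).obj c ⟶ (incl J).obj y} (C : Chart J T) :
    IsLocallyRepresentable (C.pullback hJ (f ≫ g)) ((C.pullback hJ g).pullback hJ f)
        (whiskerRightIso ((incl J).mapComp f g) T ≪≫ α_ _ _ _).hom ∧
      IsLocallyRepresentable ((C.pullback hJ g).pullback hJ f) (C.pullback hJ (f ≫ g))
        (whiskerRightIso ((incl J).mapComp f g) T ≪≫ α_ _ _ _).inv := by
  obtain ⟨v, k, hk, h, φ, e⟩ := C.exists_pullback_eq hJ g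
  rw [e]
  obtain ⟨v', k', hk', h', φ', e'⟩ := (C.pull g k hk h φ).exists_pullback_eq hJ f
  rw [e']
  have h₁ := isLocallyRepresentable_iso_of_isRepresentedBy hk'
    (whiskerRightIso ((incl J).mapComp f g) T ≪≫ α_ _ _ _) (α_ h' h C.rep)
    (isRepresentedBy_pull_comp C.iso f g k h φ k' h' φ')
  have h₂ := isLocallyRepresentable_pull_pullback hJ C (f ≫ g) k' hk' (h' ≫ h)
    (α_ h' h C.cover ≪≫ whiskerLeftIso h' φ ≪≫ (α_ h' k g).symm ≪≫ whiskerRightIso φ' g ≪≫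
      α_ k' f g)
  exact ⟨(h₂.2.comp hJ h₁.1).of_eq (Category.id_comp _),
    (h₁.2.comp hJ h₂.1).of_eq (Category.comp_id _)⟩

theorem isLocallyRepresentable_unit {a b y : K} (q : a ⟶ b) (hq : J q)
    {T : (incl J).obj a ⟶ (incl J).obj y} (c : Chart J T) :
    IsLocallyRepresentable ((c.push hJ hq (formalInverse J q hq)).pullback hJ q) c
        ((formalInverse J q hq).cancel T).hom ∧
      IsLocallyRepresentable c ((c.push hJ hq (formalInverse J q hq)).pullback hJ q)
        ((formalInverse J q hq).cancel T).inv := by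
  have h₁ := isLocallyRepresentable_iso_of_isRepresentedBy c.mem
    ((formalInverse J q hq).cancel T).symm (λ_ c.rep).symm (isRepresentedBy_pull_push c.iso _)
  have h₂ := isLocallyRepresentable_pull_pullback hJ (c.push hJ hq (formalInverse J q hq)) q
    c.cover c.mem (𝟙 _) (λ_ _)
  exact ⟨(h₂.2.comp hJ h₁.2).of_eq (Category.id_comp _),
    (h₁.1.comp hJ h₂.1).of_eq (Category.comp_id _)⟩

theorem isLocallyRepresentable_counit {a b y : K} (q : a ⟶ b) (hq : J q)
    {T : (incl J).obj b ⟶ (incl J).obj y} (c : Chart J T) :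
    IsLocallyRepresentable ((c.pullback hJ q).push hJ hq (formalInverse J q hq)) c
        ((α_ _ _ _).symm ≪≫ whiskerRightIso (formalInverse J q hq).counit T ≪≫ λ_ T).hom ∧
      IsLocallyRepresentable c ((c.pullback hJ q).push hJ hq (formalInverse J q hq))
        ((α_ _ _ _).symm ≪≫ whiskerRightIso (formalInverse J q hq).counit T ≪≫ λ_ T).inv := by
  obtain ⟨v, k, hk, h, φ, e⟩ := c.exists_pullback_eq hJ q
  rw [e]
  have h₁ := isLocallyRepresentable_iso_of_isRepresentedBy (hJ.comp_mem _ _ hk hq)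
    ((α_ _ _ _).symm ≪≫ whiskerRightIso (formalInverse J q hq).counit T ≪≫ λ_ T) (Iso.refl _)
    (isRepresentedBy_push_pull c.iso (formalInverse J q hq) k h φ)
  have h₂ := isLocallyRepresentable_restrict c h φ (hJ.comp_mem _ _ hk hq)
  exact ⟨(h₁.1.comp hJ h₂.2).of_eq (Category.comp_id _),
    (h₂.1.comp hJ h₁.2).of_eq (Category.id_comp _)⟩

/-- A 2-arrow `η : S ⟶ S'`, whiskered with `T`, is locally representable in the charts obtained from
a chart of `T`. Having `T` arbitrary is what makes the induction on `η` work: whiskering `η` on the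
right replaces `T` by a composite. -/
theorem isLocallyRepresentable_whiskerRight {a b : K} {S S' : (incl J).obj a ⟶ (incl J).obj b}
    (η : S ⟶ S') : ∀ {y : K} {T : (incl J).obj b ⟶ (incl J).obj y} (c : Chart J T),
    IsLocallyRepresentable (chartComp hJ S c) (chartComp hJ S' c) (η ▷ T) := by
  have congr {a y : K} {T T' : (incl J).obj a ⟶ (incl J).obj y} (c : Chart J T) (i : T ≅ T') :
      IsLocallyRepresentable (c.congr i) c i.symm.hom ∧
        IsLocallyRepresentable c (c.congr i) i.symm.inv :=
    (isLocallyRepresentable_congr c i).symm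
  have of_iso {a b : K} {S S' : (incl J).obj a ⟶ (incl J).obj b} (i : S ≅ S')
      (h : ∀ {y : K} {T : (incl J).obj b ⟶ (incl J).obj y} (c : Chart J T),
        IsLocallyRepresentable (chartComp hJ S c) (chartComp hJ S' c) (whiskerRightIso i T).hom ∧
          IsLocallyRepresentable (chartComp hJ S' c) (chartComp hJ S c)
            (whiskerRightIso i T).inv) :
      (∀ {y : K} {T : (incl J).obj b ⟶ (incl J).obj y} (c : Chart J T),
        IsLocallyRepresentable (chartComp hJ S c) (chartComp hJ S' c) (i.hom ▷ T)) ∧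
      ∀ {y : K} {T : (incl J).obj b ⟶ (incl J).obj y} (c : Chart J T),
        IsLocallyRepresentable (chartComp hJ S' c) (chartComp hJ S c) (i.inv ▷ T) :=
    ⟨fun c => (h c).1, fun c => (h c).2⟩
  induction η using cell_induction with
  | id f =>
    intro y T c
    rw [id_whiskerRight]
    exact isLocallyRepresentable_id _
  | comp η θ h₁ h₂ =>
    intro y T c
    rw [comp_whiskerRight]
    exact (h₁ c).comp hJ (h₂ c)
  | whiskerLeft f η h =>
    intro y T c
    rw [whisker_assoc]
    exact (isLocallyRepresentable_congr _ (α_ f _ T).symm).2.comp hJ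
      ((isLocallyRepresentable_chartComp hJ f (h c)).comp hJ
        (isLocallyRepresentable_congr _ (α_ f _ T).symm).1)
  | whiskerRight η h h₁ =>
    intro y T c
    have e : (η ▷ h) ▷ T = (α_ _ _ _).hom ≫ η ▷ (h ≫ T) ≫ (α_ _ _ _).inv := by simp
    rw [e]
    exact (isLocallyRepresentable_congr _ (α_ _ h T).symm).2.comp hJ
      ((h₁ (chartComp hJ h c)).comp hJ
        (isLocallyRepresentable_congr _ (α_ _ h T).symm).1)
  | assoc f g h =>
    refine of_iso (α_ f g h) fun {y T} c => ?_
    have h₁ := isLocallyRepresentable_congr (chartComp hJ g (chartComp hJ h c)) (α_ g h T).symm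
    have key := isLocallyRepresentable_trans hJ
      (congr _ (α_ (f ≫ g) h T).symm) (isLocallyRepresentable_trans hJ
      (congr (chartComp hJ f (chartComp hJ g (chartComp hJ h c))) (α_ f g (h ≫ T)).symm)
      (isLocallyRepresentable_trans hJ (α := whiskerLeftIso f (α_ g h T).symm)
        ⟨isLocallyRepresentable_chartComp hJ f h₁.1, isLocallyRepresentable_chartComp hJ f h₁.2⟩
        (isLocallyRepresentable_congr _ (α_ f (g ≫ h) T).symm)))
    have e : whiskerRightIso (α_ f g h) T = (α_ (f ≫ g) h T).symm.symm ≪≫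
        (α_ f g (h ≫ T)).symm.symm ≪≫ whiskerLeftIso f (α_ g h T).symm ≪≫
          (α_ f (g ≫ h) T).symm := by
      ext; simp
    rw [← e] at key
    exact key
  | leftUnitor f =>
    refine of_iso (λ_ f) fun {y T} c => ?_
    have key := isLocallyRepresentable_trans hJ (congr _ (α_ (𝟙 _) f T).symm)
      (congr (chartComp hJ f c) (λ_ (f ≫ T)).symm)
    have e : whiskerRightIso (λ_ f) T = (α_ (𝟙 _) f T).symm.symm ≪≫ (λ_ (f ≫ T)).symm.symm := by
      ext; simp
    rw [← e] at key
    exact key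
  | rightUnitor f =>
    refine of_iso (ρ_ f) fun {y T} c => ?_
    have h₁ := congr c (λ_ T).symm
    have key := isLocallyRepresentable_trans hJ (congr _ (α_ f (𝟙 _) T).symm)
      (β := whiskerLeftIso f (λ_ T))
      ⟨isLocallyRepresentable_chartComp hJ f h₁.1, isLocallyRepresentable_chartComp hJ f h₁.2⟩
    have e : whiskerRightIso (ρ_ f) T = (α_ f (𝟙 _) T).symm.symm ≪≫ whiskerLeftIso f (λ_ T) := by
      ext; simp
    rw [← e] at key
    exact key
  | of η =>
    intro y T c
    exact isLocallyRepresentable_pull hJ c η _ _ _ _ _ _ _ _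
  | mapId a =>
    refine of_iso ((incl J).mapId a) fun {y T} c => ?_
    have key := isLocallyRepresentable_trans hJ (isLocallyRepresentable_mapId hJ c)
      (isLocallyRepresentable_congr c (λ_ T).symm)
    have e : whiskerRightIso ((incl J).mapId a) T =
        (whiskerRightIso ((incl J).mapId a) T ≪≫ λ_ T) ≪≫ (λ_ T).symm := by
      ext; simp
    rw [← e] at key
    exact key
  | mapComp f g =>
    refine of_iso ((incl J).mapComp f g) fun {y T} c => ?_
    have key := isLocallyRepresentable_trans hJ (isLocallyRepresentable_mapComp hJ f g c)
      (isLocallyRepresentable_congr _ (α_ _ _ T).symm)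
    have e : whiskerRightIso ((incl J).mapComp f g) T =
        (whiskerRightIso ((incl J).mapComp f g) T ≪≫ α_ _ _ _) ≪≫ (α_ _ _ T).symm := by
      ext; simp
    rw [← e] at key
    exact key
  | counit f hf =>
    refine of_iso ((formalInverse J f hf).counit) fun {y T} c => ?_
    have key := isLocallyRepresentable_trans hJ (congr _ (α_ _ _ T).symm)
      (isLocallyRepresentable_trans hJ (isLocallyRepresentable_counit hJ f hf c)
      (isLocallyRepresentable_congr _ (λ_ T).symm))
    have e : whiskerRightIso (formalInverse J f hf).counit T = (α_ _ _ T).symm.symm ≪≫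
        ((α_ _ _ _).symm ≪≫ whiskerRightIso (formalInverse J f hf).counit T ≪≫ λ_ T) ≪≫
          (λ_ T).symm := by
      ext; simp
    rw [← e] at key
    exact key
  | unit f hf =>
    refine of_iso ((formalInverse J f hf).unit) fun {y T} c => ?_
    have key := isLocallyRepresentable_trans hJ (congr _ (λ_ T).symm)
      (isLocallyRepresentable_trans hJ
      (α := ((formalInverse J f hf).cancel T).symm) (isLocallyRepresentable_unit hJ f hf c).symm
      (isLocallyRepresentable_congr _ (α_ _ _ T).symm))
    have e : whiskerRightIso (formalInverse J f hf).unit T = (λ_ T).symm.symm ≪≫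
        ((formalInverse J f hf).cancel T).symm ≪≫ (α_ _ _ T).symm := by
      ext; simp [AdjointInverse.cancel]
    rw [← e] at key
    exact key

/-- The trivial chart of an identity. -/
noncomputable def chartId (b : K) : Chart J (𝟙 ((incl J).obj b)) :=
  ⟨b, 𝟙 b, hJ.id_mem b, 𝟙 b, ρ_ _⟩

/-- A chart of an arbitrary 1-arrow of the formal localisation. -/
noncomputable def chart {a b : K} (S : (incl J).obj a ⟶ (incl J).obj b) : Chart J S :=
  (chartComp hJ S (chartId hJ b)).congr (ρ_ S)

/-- The 2-arrows of the formal localisation are locally represented by 2-arrows of `K`. -/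
theorem isLocallyRepresentable_chart {a b : K} {S S' : (incl J).obj a ⟶ (incl J).obj b}
    (η : S ⟶ S') : IsLocallyRepresentable (chart hJ S) (chart hJ S') η := by
  have h := (isLocallyRepresentable_congr (chartComp hJ S (chartId hJ b)) (ρ_ S)).2.comp hJ
    ((isLocallyRepresentable_whiskerRight hJ η _).comp hJ
      (isLocallyRepresentable_congr (chartComp hJ S' (chartId hJ b)) (ρ_ S')).1)
  exact h.of_eq (by simp)

end FormalLoc
end TwoSite

namespace TwoSite
/-! ### Local essential smallness of the formal localisation -/

/-- A category is essentially small if its hom-sets are small and its objects are classified, up to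
isomorphism, by an invariant with values in a small type. -/
theorem essentiallySmall_of_small_invariant {C X : Type*} [Category C] [Small.{s} X] (r : C → X)
    (hr : ∀ c d, r c = r d → Nonempty (c ≅ d)) (hom : ∀ c d : C, Small.{s} (c ⟶ d)) :
    EssentiallySmall.{s} C := by
  refine (essentiallySmall_iff C).2 ⟨small_of_injective
    (f := fun c : Skeleton C => r ((fromSkeleton C).obj c)) fun c d h => ?_, ⟨hom⟩⟩
  rw [← (toSkeleton_fromSkeleton_obj c), ← (toSkeleton_fromSkeleton_obj d)]
  exact toSkeleton_eq_toSkeleton_iff.2 (hr _ _ h)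

/-- The 2-arrows that are representable along `l` inject into the 2-arrows of `K` between two fixed
arrows, because restriction along `l` is faithful. -/
theorem small_isRepresentableOn {K M : Type*} [Bicategory K] [Bicategory M] {Q : K ⥤ᵖ M}
    {J : MorphismProperty K} (hJ : IsFFSingletonCoverage J)
    (hK : ∀ {x y : K} (f g : x ⟶ y), Small.{s} (f ⟶ g)) (hQ : Inverts Q J)
    {x y : K} {T T' : Q.obj x ⟶ Q.obj y} (c : Chart J T) (d : Chart J T') {v : K} (l : v ⟶ x)
    (hl : J l) : Small.{s} {η : T ⟶ T' // IsRepresentableOn c d η l} := by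
  rcases isEmpty_or_nonempty {η : T ⟶ T' // IsRepresentableOn c d η l} with _ | ⟨_, h⟩
  · infer_instance
  · obtain ⟨s, σ, t, τ, -, -⟩ := h
    have H (η : {η : T ⟶ T' // IsRepresentableOn c d η l}) :=
      η.2.exists_isRepresentedBy hJ s σ t τ
    choose β hβ using H
    have := hK (s ≫ c.rep) (t ≫ d.rep)
    refine small_of_injective (f := β) fun η θ h => Subtype.ext ?_
    refine (hQ l hl).whiskerLeft_injective ?_
    rw [← cancel_mono (restrictIso d.iso t τ).hom]
    exact (hβ η).trans (h ▸ Eq.symm (hβ θ))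

theorem FormalLoc.isLocallyEssentiallySmall {K : Type u} [Bicategory.{w, v} K]
    {J V : MorphismProperty K} (hJ : IsFFSingletonCoverage J)
    (hK : IsLocallyEssentiallySmall.{s} K) (hV : IsCofinal V J) (hs : IsLocallySmallClass.{s} V) :
    IsLocallyEssentiallySmall.{s} (FormalLoc J) := by
  rintro ⟨x⟩ ⟨y⟩
  change EssentiallySmall.{s} ((incl J).obj x ⟶ (incl J).obj y)
  have := hs x
  have := hK
  have (p : {f : Σ z : K, (z ⟶ x) // V f.2}) : Small.{s} (Skeleton (p.1.1 ⟶ y)) :=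
    have := hK p.1.1 y
    small_skeleton_of_essentiallySmall _
  have cof {v : K} (l : v ⟶ x) (hl : J l) : ∃ (p : {f : Σ z : K, (z ⟶ x) // V f.2})
      (s : p.1.1 ⟶ v), Nonempty (s ≫ l ≅ p.1.2) := by
    obtain ⟨z, g, s, hg, i⟩ := hV.2 l hl
    exact ⟨⟨⟨z, g⟩, hg⟩, s, i⟩
  have H (S : (incl J).obj x ⟶ (incl J).obj y) :
      ∃ r : Σ p : {f : Σ z : K, (z ⟶ x) // V f.2}, Skeleton (p.1.1 ⟶ y),
        Nonempty ((incl J).map r.1.1.2 ≫ S ≅ (incl J).map ((fromSkeleton _).obj r.2)) := by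
    obtain ⟨p, s, ⟨σ⟩⟩ := cof _ (chart hJ S).mem
    refine ⟨⟨p, toSkeleton (s ≫ (chart hJ S).rep)⟩, ⟨restrictIso (chart hJ S).iso s σ ≪≫
      (incl J).map₂Iso (fromSkeletonToSkeletonIso _).symm⟩⟩
  choose r hr using H
  -- The invariant of `S` consists of an arrow `l` in `V` and the class of an arrow of `K` that
  -- represents the restriction of `S` along `l`; it determines `S` because `l` is inverted.
  refine essentiallySmall_of_small_invariant r (fun S T h => ?_) fun S T => ?_
  · obtain ⟨κ⟩ := hr S
    rw [h] at κ
    obtain ⟨κ'⟩ := hr T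
    exact (inverts_incl _ (hV.1 _ (r T).1.2)).nonempty_iso_of_comp (κ ≪≫ κ'.symm)
  · have H (η : S ⟶ T) : ∃ p : {f : Σ z : K, (z ⟶ x) // V f.2},
        IsRepresentableOn (chart hJ S) (chart hJ T) η p.1.2 := by
      obtain ⟨v, l, hl, h⟩ := isLocallyRepresentable_chart hJ η
      obtain ⟨p, s, ⟨σ⟩⟩ := cof l hl
      exact ⟨p, h.refine s σ⟩
    choose p hp using H
    have (p : {f : Σ z : K, (z ⟶ x) // V f.2}) :
        Small.{s} {η : S ⟶ T // IsRepresentableOn (chart hJ S) (chart hJ T) η p.1.2} :=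
      small_isRepresentableOn hJ (fun {x y} f g =>
        have := hK x y
        have := locallySmall_of_essentiallySmall.{s} (x ⟶ y)
        LocallySmall.hom_small f g) inverts_incl _ _ _ (hV.1 _ p.2)
    exact small_of_injective (β := Σ p : {f : Σ z : K, (z ⟶ x) // V f.2},
        {η : S ⟶ T // IsRepresentableOn (chart hJ S) (chart hJ T) η p.1.2})
      (f := fun η => ⟨p η, η, hp η⟩) fun η θ h => congrArg (fun q => q.2.1) h
end TwoSite

namespace TwoSite

/-! ### Detecting equivalences -/

section TwoOutOfSix

variable {B : Type*} [Bicategory B]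

/-- If `p ≫ q` and `q ≫ r` are equivalences, so is `r`. -/
theorem IsEquiv.of_comp_of_comp {a b c d : B} {p : a ⟶ b} {q : b ⟶ c} {r : c ⟶ d}
    (h : IsEquiv (p ≫ q)) (h' : IsEquiv (q ≫ r)) : IsEquiv r := by
  obtain ⟨s, -, ⟨η⟩⟩ := h
  obtain ⟨t, ⟨θ⟩, ⟨ι⟩⟩ := h'
  have i : s ≫ p ≅ r ≫ t :=
    (ρ_ _).symm ≪≫ whiskerLeftIso (s ≫ p) (θ.symm ≪≫ α_ _ _ _) ≪≫ (α_ _ _ _).symm ≪≫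
      whiskerRightIso (α_ _ _ _ ≪≫ η) _ ≪≫ λ_ _
  have hq : IsEquiv q := ⟨s ≫ p, ⟨whiskerLeftIso q i ≪≫ (α_ _ _ _).symm ≪≫ θ⟩,
    ⟨α_ _ _ _ ≪≫ η⟩⟩
  refine ⟨t ≫ q, ?_, ⟨α_ _ _ _ ≪≫ ι⟩⟩
  exact hq.nonempty_iso_of_comp ((α_ _ _ _).symm ≪≫ (α_ _ _ _).symm ≪≫
    whiskerRightIso (α_ _ _ _ ≪≫ (α_ _ _ _).symm ≪≫ θ) q ≪≫ λ_ q ≪≫ (ρ_ q).symm)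

/-- A strong transformation that is an equivalence has components that are equivalences. -/
theorem IsEquiv.app {C : Type*} [Bicategory C] {F G : B ⥤ᵖ C} {θ : F ⟶ G} (h : IsEquiv θ)
    (a : B) : IsEquiv (θ.app a) := by
  obtain ⟨ι, ⟨η⟩, ⟨κ⟩⟩ := h
  refine ⟨ι.app a, ⟨⟨η.hom.as.app a, η.inv.as.app a, ?_, ?_⟩⟩,
    ⟨⟨κ.hom.as.app a, κ.inv.as.app a, ?_, ?_⟩⟩⟩
  · exact congrArg (fun Γ => Γ.as.app a) η.hom_inv_id
  · exact congrArg (fun Γ => Γ.as.app a) η.inv_hom_id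
  · exact congrArg (fun Γ => Γ.as.app a) κ.hom_inv_id
  · exact congrArg (fun Γ => Γ.as.app a) κ.inv_hom_id

/-- A 2-functor that is locally an equivalence reflects equivalences. -/
theorem IsEquiv.exists_of_map {C : Type*} [Bicategory C] (P : B ⥤ᵖ C)
    (hP : ∀ a b : B, (P.mapFunctor a b).IsEquivalence) {a b : B} {f : P.obj a ⟶ P.obj b}
    (hf : IsEquiv f) : ∃ g : a ⟶ b, IsEquiv g := by
  obtain ⟨f', ⟨η⟩, ⟨θ⟩⟩ := hf
  have iso {a b : B} {g h : a ⟶ b} (i : P.map g ≅ P.map h) : Nonempty (g ≅ h) :=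
    have := hP a b
    ⟨(P.mapFunctor a b).preimageIso i⟩
  have lift {a b : B} (f : P.obj a ⟶ P.obj b) : ∃ g : a ⟶ b, Nonempty (P.map g ≅ f) :=
    have := hP a b
    ⟨(P.mapFunctor a b).objPreimage f, ⟨(P.mapFunctor a b).objObjPreimageIso f⟩⟩
  obtain ⟨g, ⟨i⟩⟩ := lift f
  obtain ⟨g', ⟨i'⟩⟩ := lift f'
  exact ⟨g, g', iso (P.mapComp g g' ≪≫ whiskerRightIso i _ ≪≫ whiskerLeftIso _ i' ≪≫ η ≪≫
    (P.mapId a).symm), iso (P.mapComp g' g ≪≫ whiskerRightIso i' _ ≪≫ whiskerLeftIso _ i ≪≫ θ ≪≫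
    (P.mapId b).symm)⟩

end TwoOutOfSix

/-! ### Inverting weak equivalences -/

section WeakEquivalences

variable {K : Type*} [Bicategory K] {J : MorphismProperty K}

theorem IsFFSingletonCoverage.le_weakEquivalences (hJ : IsFFSingletonCoverage J) :
    J ≤ weakEquivalences J :=
  fun x _ f hf => ⟨hJ.ff f hf, x, f, 𝟙 x, hf, ⟨λ_ f⟩⟩

/-- A 2-functor that inverts `J` also inverts the weak equivalences. -/
theorem Inverts.weakEquivalences (hJ : IsFFSingletonCoverage J) {A : Type*} [Bicategory A]
    {F : K ⥤ᵖ A} (hF : Inverts F J) : Inverts F (weakEquivalences J) := by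
  rintro x y f ⟨hf, u, j, s, hj, ⟨i⟩⟩
  -- The pullback of `j` along `f` factors through `s`, because `f` is ff.
  obtain ⟨v, k, g, hk, ⟨φ⟩⟩ := hJ.exists_square j f hj
  obtain ⟨γ, -⟩ := hf.exists_iso (α_ g s f ≪≫ whiskerLeftIso g i ≪≫ φ)
  exact ((hF k hk).of_iso (F.map₂Iso γ.symm ≪≫ F.mapComp g s)).of_comp_of_comp
    ((hF j hj).of_iso (F.map₂Iso i.symm ≪≫ F.mapComp s f))

theorem isLocalisation_weakEquivalences_iff (hJ : IsFFSingletonCoverage J)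
    {L : Type*} [Bicategory L] (Q : K ⥤ᵖ L) :
    IsLocalisation.{wA, vA, uA} Q (weakEquivalences J) ↔ IsLocalisation.{wA, vA, uA} Q J := by
  refine ⟨fun h => ⟨?_, ?_, ?_⟩, fun h => ⟨?_, ?_, ?_⟩⟩
  · exact fun _ _ f hf => h.inverts f (hJ.le_weakEquivalences f hf)
  · exact fun A _ F hF => h.essSurj A F (hF.weakEquivalences hJ)
  · exact h.locally_equivalence
  · exact h.inverts.weakEquivalences hJ
  · exact fun A _ F hF => h.essSurj A F fun _ _ f hf => hF f (hJ.le_weakEquivalences f hf)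
  · exact h.locally_equivalence

end WeakEquivalences

/-! ### Postcomposition of transformations -/

section Postcomposition

variable {B C D : Type*} [Bicategory B] [Bicategory C] [Bicategory D]

theorem map₂_rightUnitor_inv (H : C ⥤ᵖ D) {a b : C} (f : a ⟶ b) : H.map₂ (ρ_ f).inv =
    (ρ_ (H.map f)).inv ≫ H.map f ◁ (H.mapId b).inv ≫ (H.mapComp f (𝟙 b)).inv := by
  rw [← PrelaxFunctor.map₂Iso_inv, Iso.inv_ext (f := H.map₂Iso _)]
  simp

/-- The image of a square that commutes up to an invertible 2-arrow. -/
def mapSquare (H : C ⥤ᵖ D) {a b a' b' : C} {p : a ⟶ b} {g : b ⟶ b'} {f : a ⟶ a'} {q : a' ⟶ b'}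
    (n : p ≫ g ≅ f ≫ q) : H.map p ≫ H.map g ≅ H.map f ≫ H.map q :=
  (H.mapComp p g).symm ≪≫ H.map₂Iso n ≪≫ H.mapComp f q

theorem mapSquare_hom (H : C ⥤ᵖ D) {a b a' b' : C} {p : a ⟶ b} {g : b ⟶ b'} {f : a ⟶ a'}
    {q : a' ⟶ b'} (n : p ≫ g ≅ f ≫ q) :
    (mapSquare H n).hom = (H.mapComp p g).inv ≫ H.map₂ n.hom ≫ (H.mapComp f q).hom :=
  rfl

theorem mapSquare_naturality (H : C ⥤ᵖ D) {a b a' b' : C} {p p' : a ⟶ b} {g : b ⟶ b'} {f : a ⟶ a'}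
    {q q' : a' ⟶ b'} {n : p ≫ g ≅ f ≫ q} {n' : p' ≫ g ≅ f ≫ q'} {η : p ⟶ p'} {θ : q ⟶ q'}
    (h : η ▷ g ≫ n'.hom = n.hom ≫ f ◁ θ) :
    H.map₂ η ▷ H.map g ≫ (mapSquare H n').hom = (mapSquare H n).hom ≫ H.map f ◁ H.map₂ θ := by
  have := congrArg H.map₂ h
  simp only [PrelaxFunctor.map₂_comp, Pseudofunctor.map₂_whisker_right,
    Pseudofunctor.map₂_whisker_left, Category.assoc] at this
  rw [← cancel_epi (H.mapComp p g).hom, mapSquare_hom, reassoc_of% this]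
  simp [mapSquare_hom]

theorem mapSquare_id (H : C ⥤ᵖ D) {a b : C} {p : a ⟶ a} {q : b ⟶ b} {f : a ⟶ b}
    {n : p ≫ f ≅ f ≫ q} (i : p ≅ 𝟙 a) (j : q ≅ 𝟙 b)
    (h : n.hom ≫ f ◁ j.hom = i.hom ▷ f ≫ (λ_ f).hom ≫ (ρ_ f).inv) :
    (mapSquare H n).hom ≫ H.map f ◁ (H.map₂ j.hom ≫ (H.mapId b).hom) =
      (H.map₂ i.hom ≫ (H.mapId a).hom) ▷ H.map f ≫ (λ_ (H.map f)).hom ≫ (ρ_ (H.map f)).inv := by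
  have := congrArg H.map₂ h
  simp only [PrelaxFunctor.map₂_comp, Pseudofunctor.map₂_whisker_right,
    Pseudofunctor.map₂_whisker_left, Category.assoc] at this
  rw [← cancel_epi (H.mapComp p f).hom, mapSquare_hom, whiskerLeft_comp,
    ← cancel_mono (H.map f ◁ (H.mapId b).inv), ← cancel_mono (H.mapComp f (𝟙 b)).inv]
  simp [this, map₂_rightUnitor_inv]

/-- Images of squares are compatible with horizontal pasting. -/
theorem mapSquare_comp (H : C ⥤ᵖ D) {a b c a' b' c' : C} {p : a ⟶ b} {p' : b ⟶ c} {f : a ⟶ a'}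
    {g : b ⟶ b'} {h : c ⟶ c'} {q : a' ⟶ b'} {q' : b' ⟶ c'} {r : a ⟶ c} {r' : a' ⟶ c'}
    {n : p ≫ g ≅ f ≫ q} {n' : p' ≫ h ≅ g ≫ q'} {m : r ≫ h ≅ f ≫ r'} (i : r ≅ p ≫ p')
    (j : r' ≅ q ≫ q') (e : m.hom ≫ f ◁ j.hom = i.hom ▷ h ≫ (α_ _ _ _).hom ≫ p ◁ n'.hom ≫
      (α_ _ _ _).inv ≫ n.hom ▷ q' ≫ (α_ _ _ _).hom) :
    (mapSquare H m).hom ≫ H.map f ◁ (H.map₂ j.hom ≫ (H.mapComp q q').hom) =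
      (H.map₂ i.hom ≫ (H.mapComp p p').hom) ▷ H.map h ≫ (α_ _ _ _).hom ≫
        H.map p ◁ (mapSquare H n').hom ≫ (α_ _ _ _).inv ≫ (mapSquare H n).hom ▷ H.map q' ≫
          (α_ _ _ _).hom := by
  have := congrArg H.map₂ e
  simp only [PrelaxFunctor.map₂_comp, Pseudofunctor.map₂_whisker_right,
    Pseudofunctor.map₂_whisker_left, Category.assoc] at this
  rw [← cancel_epi (H.mapComp r h).hom, mapSquare_hom, whiskerLeft_comp,
    ← cancel_mono (H.map f ◁ (H.mapComp q q').inv), ← cancel_mono (H.mapComp f (q ≫ q')).inv]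
  simp [this, map₂_associator_inv, mapSquare_hom]

/-- Images of squares are compatible with vertical pasting. -/
theorem mapSquare_vcomp (H : C ⥤ᵖ D) {a b a' b' a'' b'' : C} {p : a ⟶ b} {q : a' ⟶ b'}
    {r : a'' ⟶ b''} {s : a ⟶ a'} {t : a' ⟶ a''} {s' : b ⟶ b'} {t' : b' ⟶ b''} {u : a ⟶ a''}
    {u' : b ⟶ b''} {n : p ≫ s' ≅ s ≫ q} {n' : q ≫ t' ≅ t ≫ r} {m : p ≫ u' ≅ u ≫ r}
    (i : s ≫ t ⟶ u) (i' : s' ≫ t' ⟶ u') (e : p ◁ i' ≫ m.hom = ((α_ _ _ _).inv ≫ n.hom ▷ t' ≫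
      (α_ _ _ _).hom ≫ s ◁ n'.hom ≫ (α_ _ _ _).inv) ≫ i ▷ r) :
    H.map p ◁ ((H.mapComp s' t').inv ≫ H.map₂ i') ≫ (mapSquare H m).hom =
      ((α_ _ _ _).inv ≫ (mapSquare H n).hom ▷ H.map t' ≫ (α_ _ _ _).hom ≫
        H.map s ◁ (mapSquare H n').hom ≫ (α_ _ _ _).inv) ≫
          ((H.mapComp s t).inv ≫ H.map₂ i) ▷ H.map r := by
  have := congrArg H.map₂ e
  simp only [PrelaxFunctor.map₂_comp, Pseudofunctor.map₂_whisker_right,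
    Pseudofunctor.map₂_whisker_left, Category.assoc] at this
  rw [← cancel_epi (H.map p ◁ (H.mapComp s' t').hom), ← cancel_epi (H.mapComp p (s' ≫ t')).hom,
    ← cancel_mono (H.mapComp u r).inv, mapSquare_hom, whiskerLeft_comp]
  simp [this, map₂_associator_inv, mapSquare_hom]

/-- The strong transformation `H ∘ F ⟶ H ∘ G` obtained from `θ : F ⟶ G` by postcomposition. -/
def postcompTrans (H : C ⥤ᵖ D) {F G : B ⥤ᵖ C} (θ : F ⟶ G) : F.comp H ⟶ G.comp H where
  app a := H.map (θ.app a)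
  naturality f := mapSquare H (θ.naturality f)
  naturality_naturality η := mapSquare_naturality H (θ.naturality_naturality η)
  naturality_id a := mapSquare_id H (F.mapId a) (G.mapId a) (θ.naturality_id a)
  naturality_comp f g := mapSquare_comp H (F.mapComp f g) (G.mapComp f g) (θ.naturality_comp f g)

theorem IsEquiv.postcompTrans (H : C ⥤ᵖ D) {F G : B ⥤ᵖ C} {θ : F ⟶ G} (h : IsEquiv θ) :
    IsEquiv (postcompTrans H θ) := by
  have comp {F G I : B ⥤ᵖ C} (θ : F ⟶ G) (ι : G ⟶ I) (κ : F ⟶ I) (i : θ ≫ ι ≅ κ) :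
      Nonempty (TwoSite.postcompTrans H θ ≫ TwoSite.postcompTrans H ι ≅
        TwoSite.postcompTrans H κ) := by
    refine ⟨Pseudofunctor.StrongTrans.isoMk
      (fun a => (H.mapComp (θ.app a) (ι.app a)).symm ≪≫
        H.map₂Iso ⟨i.hom.as.app a, i.inv.as.app a, congrArg (fun Γ => Γ.as.app a) i.hom_inv_id,
          congrArg (fun Γ => Γ.as.app a) i.inv_hom_id⟩) fun {a b} f => ?_⟩
    have h := i.hom.as.naturality f
    rw [Pseudofunctor.StrongTrans.categoryStruct_comp_naturality_hom] at h ⊢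
    exact mapSquare_vcomp H _ _ h
  have id (F : B ⥤ᵖ C) : Nonempty (TwoSite.postcompTrans H (𝟙 F) ≅ 𝟙 (F.comp H)) := by
    refine ⟨Pseudofunctor.StrongTrans.isoMk (fun a => H.mapId (F.obj a)) fun {a b} f => ?_⟩
    change H.map (F.map f) ◁ (H.mapId (F.obj b)).hom ≫ (ρ_ _).hom ≫ (λ_ _).inv =
      ((H.mapComp (F.map f) (𝟙 (F.obj b))).inv ≫ H.map₂ ((ρ_ (F.map f)).hom ≫ (λ_ (F.map f)).inv) ≫
        (H.mapComp (𝟙 (F.obj a)) (F.map f)).hom) ≫ (H.mapId (F.obj a)).hom ▷ H.map (F.map f)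
    simp [map₂_leftUnitor_inv]
  obtain ⟨ι, ⟨η⟩, ⟨κ⟩⟩ := h
  exact ⟨TwoSite.postcompTrans H ι, ⟨(comp _ _ _ η).some ≪≫ (id F).some⟩,
    ⟨(comp _ _ _ κ).some ≪≫ (id G).some⟩⟩

end Postcomposition
end TwoSite

namespace TwoSite

/-! ### Change of universe -/

/-- A copy of a bicategory whose objects, 1-arrows and 2-arrows live in larger universes. The
universes `v₁` and `w₁` of the 1-arrows and 2-arrows occur in the definition so that they can be
recovered from the type. -/
def Up.{w₁, v₁, u₁, u₀} (B : Type u₀) : Type (max u₀ u₁) :=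
  Function.const (PUnit.{w₁ + 1} × PUnit.{v₁ + 1}) (ULift.{u₁} B) ⟨⟨⟩, ⟨⟩⟩

namespace Up

variable {B : Type u} [Bicategory.{w, v} B]

/-- The underlying object. -/
def down (a : Up.{w', v', u'} B) : B :=
  ULift.down (show ULift.{u'} B from a)

/-- Lift an object. -/
def up (a : B) : Up.{w', v', u'} B :=
  show ULift.{u'} B from ULift.up a

/-- The 1-arrows of the lifted bicategory. -/
structure Hom (a b : Up.{w', v', u'} B) : Type (max v v') where
  /-- Lift a 1-arrow. -/
  up ::
  /-- The underlying 1-arrow. -/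
  down : a.down ⟶ b.down

instance : CategoryStruct (Up.{w', v', u'} B) where
  Hom a b := Hom a b
  id a := ⟨𝟙 a.down⟩
  comp f g := ⟨f.down ≫ g.down⟩

/-- The 2-arrows of the lifted bicategory. -/
@[ext]
structure Hom₂ {a b : Up.{w', v', u'} B} (f g : a ⟶ b) : Type (max w w') where
  /-- Lift a 2-arrow. -/
  up ::
  /-- The underlying 2-arrow. -/
  down : f.down ⟶ g.down

instance (a b : Up.{w', v', u'} B) : Category (a ⟶ b) where
  Hom f g := Hom₂ f g
  id f := ⟨𝟙 f.down⟩
  comp η θ := ⟨η.down ≫ θ.down⟩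
  id_comp _ := Hom₂.ext (Category.id_comp _)
  comp_id _ := Hom₂.ext (Category.comp_id _)
  assoc _ _ _ := Hom₂.ext (Category.assoc _ _ _)

/-- Lift an invertible 2-arrow. -/
def isoMk {a b : Up.{w', v', u'} B} {f g : a ⟶ b} (i : f.down ≅ g.down) : f ≅ g where
  hom := ⟨i.hom⟩
  inv := ⟨i.inv⟩
  hom_inv_id := Hom₂.ext i.hom_inv_id
  inv_hom_id := Hom₂.ext i.inv_hom_id

instance : Bicategory (Up.{w', v', u'} B) where
  whiskerLeft f _ _ η := Hom₂.up (f.down ◁ Hom₂.down η)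
  whiskerRight η h := Hom₂.up (Hom₂.down η ▷ h.down)
  associator f g h := isoMk (α_ f.down g.down h.down)
  leftUnitor f := isoMk (λ_ f.down)
  rightUnitor f := isoMk (ρ_ f.down)
  whiskerLeft_id _ _ := Hom₂.ext (whiskerLeft_id _ _)
  whiskerLeft_comp _ _ _ _ _ _ := Hom₂.ext (whiskerLeft_comp _ _ _)
  id_whiskerLeft _ := Hom₂.ext (id_whiskerLeft _)
  comp_whiskerLeft _ _ _ _ _ := Hom₂.ext (comp_whiskerLeft _ _ _)
  id_whiskerRight _ _ := Hom₂.ext (id_whiskerRight _ _)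
  comp_whiskerRight _ _ _ := Hom₂.ext (comp_whiskerRight _ _ _)
  whiskerRight_id _ := Hom₂.ext (whiskerRight_id _)
  whiskerRight_comp _ _ _ := Hom₂.ext (whiskerRight_comp _ _ _)
  whisker_assoc _ _ _ _ _ := Hom₂.ext (whisker_assoc _ _ _)
  whisker_exchange _ _ := Hom₂.ext (whisker_exchange _ _)
  pentagon _ _ _ _ := Hom₂.ext (pentagon _ _ _ _)
  triangle _ _ := Hom₂.ext (triangle _ _)

variable (B)

/-- The strict 2-functor to the lifted bicategory. -/
def upFunctor : B ⥤ᵖ Up.{w', v', u'} B where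
  obj a := up a
  map f := Hom.up f
  map₂ η := Hom₂.up η
  mapId _ := Iso.refl _
  mapComp _ _ := Iso.refl _
  map₂_id _ := rfl
  map₂_comp _ _ := rfl
  map₂_whisker_left f _ _ η := Hom₂.ext (show f ◁ η = 𝟙 _ ≫ f ◁ η ≫ 𝟙 _ by simp)
  map₂_whisker_right η h := Hom₂.ext (show η ▷ h = 𝟙 _ ≫ η ▷ h ≫ 𝟙 _ by simp)
  map₂_associator f g h := Hom₂.ext
    (show (α_ f g h).hom = 𝟙 _ ≫ 𝟙 _ ▷ h ≫ (α_ f g h).hom ≫ f ◁ 𝟙 _ ≫ 𝟙 _ by simp)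
  map₂_left_unitor f := Hom₂.ext (show (λ_ f).hom = 𝟙 _ ≫ 𝟙 _ ▷ f ≫ (λ_ f).hom by simp)
  map₂_right_unitor f := Hom₂.ext (show (ρ_ f).hom = 𝟙 _ ≫ f ◁ 𝟙 _ ≫ (ρ_ f).hom by simp)

/-- The strict 2-functor from the lifted bicategory. -/
def downFunctor : Up.{w', v', u'} B ⥤ᵖ B where
  obj a := a.down
  map f := Hom.down f
  map₂ η := Hom₂.down η
  mapId _ := Iso.refl _
  mapComp _ _ := Iso.refl _
  map₂_id _ := rfl
  map₂_comp _ _ := rfl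
  map₂_whisker_left f _ _ η := show Hom.down f ◁ Hom₂.down η =
    𝟙 _ ≫ Hom.down f ◁ Hom₂.down η ≫ 𝟙 _ by simp
  map₂_whisker_right η h := show Hom₂.down η ▷ Hom.down h =
    𝟙 _ ≫ Hom₂.down η ▷ Hom.down h ≫ 𝟙 _ by simp
  map₂_associator f g h := show (α_ (Hom.down f) (Hom.down g) (Hom.down h)).hom =
    𝟙 _ ≫ 𝟙 _ ▷ Hom.down h ≫ (α_ _ _ _).hom ≫ Hom.down f ◁ 𝟙 _ ≫ 𝟙 _ by simp
  map₂_left_unitor f := show (λ_ (Hom.down f)).hom =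
    𝟙 _ ≫ 𝟙 _ ▷ Hom.down f ≫ (λ_ (Hom.down f)).hom by simp
  map₂_right_unitor f := show (ρ_ (Hom.down f)).hom =
    𝟙 _ ≫ Hom.down f ◁ 𝟙 _ ≫ (ρ_ (Hom.down f)).hom by simp

end Up

/-! ### Local essential smallness of arbitrary localisations -/

theorem IsEquiv.comp {B : Type*} [Bicategory B] {a b c : B} {f : a ⟶ b} {g : b ⟶ c}
    (hf : IsEquiv f) (hg : IsEquiv g) : IsEquiv (f ≫ g) := by
  obtain ⟨f', ⟨η⟩, ⟨θ⟩⟩ := hf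
  obtain ⟨g', ⟨ι⟩, ⟨κ⟩⟩ := hg
  exact ⟨g' ≫ f', ⟨α_ _ _ _ ≪≫ whiskerLeftIso f ((α_ _ _ _).symm ≪≫ whiskerRightIso ι f' ≪≫ λ_ _) ≪≫
    η⟩, ⟨α_ _ _ _ ≪≫ whiskerLeftIso g' ((α_ _ _ _).symm ≪≫ whiskerRightIso θ g ≪≫ λ_ _) ≪≫ κ⟩⟩

theorem comp_assoc {A B C D : Type*} [Bicategory A] [Bicategory B] [Bicategory C] [Bicategory D]
    (F : A ⥤ᵖ B) (G : B ⥤ᵖ C) (H : C ⥤ᵖ D) : (F.comp G).comp H = F.comp (G.comp H) :=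
  pseudofunctor_ext _ _ rfl (fun a => heq_of_eq (Iso.ext
      (show H.map₂ (G.map₂ (F.mapId a).hom ≫ (G.mapId _).hom) ≫ (H.mapId _).hom =
        H.map₂ (G.map₂ (F.mapId a).hom) ≫ H.map₂ (G.mapId _).hom ≫ (H.mapId _).hom by simp)))
    (fun _ _ _ f g => heq_of_eq (Iso.ext
      (show H.map₂ (G.map₂ (F.mapComp f g).hom ≫ (G.mapComp _ _).hom) ≫ (H.mapComp _ _).hom =
        H.map₂ (G.map₂ (F.mapComp f g).hom) ≫ H.map₂ (G.mapComp _ _).hom ≫ (H.mapComp _ _).hom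
        by simp)))

theorem comp_up_comp_down {A B C : Type*} [Bicategory A] [Bicategory B] [Bicategory C]
    (F : A ⥤ᵖ B) (G : B ⥤ᵖ C) :
    (F.comp (Up.upFunctor.{_, _, _, w', v', u'} B)).comp ((Up.downFunctor B).comp G) = F.comp G :=
  pseudofunctor_ext _ _ rfl
    (fun a => heq_of_eq (Iso.ext
      (show G.map₂ ((F.mapId a).hom ≫ 𝟙 _) ≫ G.map₂ (𝟙 _) ≫ (G.mapId _).hom =
        G.map₂ (F.mapId a).hom ≫ (G.mapId _).hom by simp)))
    (fun _ _ _ f g => heq_of_eq (Iso.ext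
      (show G.map₂ ((F.mapComp f g).hom ≫ 𝟙 _) ≫ G.map₂ (𝟙 _) ≫ (G.mapComp _ _).hom =
        G.map₂ (F.mapComp f g).hom ≫ (G.mapComp _ _).hom by simp)))

/-- Local essential smallness is inherited along a 2-functor that has a left inverse up to
equivalence. -/
theorem isLocallyEssentiallySmall_of_isEquiv {L M : Type*} [Bicategory L] [Bicategory M]
    (hM : IsLocallyEssentiallySmall.{s} M) (P : L ⥤ᵖ M) (R : M ⥤ᵖ Up.{w', v', u'} L)
    {θ : P.comp R ⟶ Up.upFunctor L} (hθ : IsEquiv θ) : IsLocallyEssentiallySmall.{s} L := by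
  intro x y
  have := hM (P.obj x) (P.obj y)
  have := small_skeleton_of_essentiallySmall.{s} (P.obj x ⟶ P.obj y)
  have := locallySmall_of_essentiallySmall.{s} (P.obj x ⟶ P.obj y)
  refine essentiallySmall_of_small_invariant (fun f : x ⟶ y => toSkeleton (P.map f))
    (fun f g h => ?_) fun f g => ?_
  · obtain ⟨i⟩ := toSkeleton_eq_toSkeleton_iff.1 h
    obtain ⟨j⟩ := (hθ.app x).nonempty_iso_of_comp
      ((θ.naturality f).symm ≪≫ whiskerRightIso (R.map₂Iso i) _ ≪≫ θ.naturality g)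
    exact ⟨j.hom.down, j.inv.down, congrArg Up.Hom₂.down j.hom_inv_id,
      congrArg Up.Hom₂.down j.inv_hom_id⟩
  · have := LocallySmall.hom_small.{s} (P.map f) (P.map g)
    refine small_of_injective (f := fun η : f ⟶ g => P.map₂ η) fun η η' h => ?_
    have e : (Up.upFunctor.{_, _, _, w', v', u'} L).map₂ η =
        (Up.upFunctor.{_, _, _, w', v', u'} L).map₂ η' := by
      refine (hθ.app x).whiskerLeft_injective ?_
      have h₁ := θ.naturality_naturality η
      have h₂ := θ.naturality_naturality η'
      have h₃ : (P.comp R).map₂ η = (P.comp R).map₂ η' := congrArg R.map₂ h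
      rw [h₃, h₂] at h₁
      exact ((cancel_epi _).1 h₁).symm
    exact congrArg Up.Hom₂.down e

theorem isEquiv_hom {B : Type*} [Bicategory B] {a b : B} (e : a ≌ b) : IsEquiv e.hom :=
  ⟨e.inv, ⟨e.unit.symm⟩, ⟨e.counit⟩⟩

theorem Inverts.comp {A B C : Type*} [Bicategory A] [Bicategory B] [Bicategory C]
    {W : MorphismProperty A} {F : A ⥤ᵖ B} (hF : Inverts F W) (G : B ⥤ᵖ C) :
    Inverts (F.comp G) W :=
  fun _ _ f hf => (hF f hf).map G

/-- If the formal localisation is locally essentially small, so is every localisation that is tested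
against bicategories in large enough universes. -/
theorem IsLocalisation.isLocallyEssentiallySmall {K : Type u} [Bicategory.{w, v} K]
    {W : MorphismProperty K} (hW : IsLocallyEssentiallySmall.{s} (FormalLoc W)) {L : Type u'}
    [Bicategory.{w', v'} L] {Q : K ⥤ᵖ L}
    (hQ : IsLocalisation.{max u v w w', max u v v', max u u'} Q W) :
    IsLocallyEssentiallySmall.{s} L := by
  obtain ⟨F, ⟨e⟩⟩ := (FormalLoc.isLocalisation_incl (W := W)).essSurj
    (Up.{max u v w, max u v, u} L) (Q.comp (Up.upFunctor L)) (hQ.inverts.comp _)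
  obtain ⟨G, ⟨e'⟩⟩ := hQ.essSurj (Up.{w', v', u'} (FormalLoc W))
    ((FormalLoc.incl W).comp (Up.upFunctor _)) (FormalLoc.inverts_incl.comp _)
  -- Precomposed with `Q`, the composite `L ⥤ᵖ FormalLoc W ⥤ᵖ Up L` becomes equivalent to the
  -- 2-functor `L ⥤ᵖ Up L`; by local equivalence it is so before precomposition.
  have h := (isEquiv_hom e').postcompTrans ((Up.downFunctor (FormalLoc W)).comp F)
  obtain ⟨τ, hτ⟩ : ∃ τ : Q.comp ((G.comp (Up.downFunctor (FormalLoc W))).comp F) ⟶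
      Q.comp (Up.upFunctor L), IsEquiv τ := by
    have h' : ∃ τ : (Q.comp G).comp ((Up.downFunctor (FormalLoc W)).comp F) ⟶
      ((FormalLoc.incl W).comp (Up.upFunctor _)).comp ((Up.downFunctor (FormalLoc W)).comp F),
        IsEquiv τ := ⟨_, h⟩
    rw [comp_assoc, comp_up_comp_down] at h'
    rw [comp_assoc]
    obtain ⟨τ, hτ⟩ := h'
    exact ⟨_, hτ.comp (isEquiv_hom e)⟩
  obtain ⟨θ, hθ⟩ := IsEquiv.exists_of_map (precomposition Q (Up.{max u v w, max u v, u} L))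
    (hQ.locally_equivalence _) hτ
  exact isLocallyEssentiallySmall_of_isEquiv hW _ _ hθ

end TwoSite

theorem mainTheorem3
    {K : Type u} [Bicategory.{w, v} K] [Bicategory.Strict K]
    (J : MorphismProperty K) (hJ : TwoSite.IsFFSingletonCoverage J)
    (hK : TwoSite.IsLocallyEssentiallySmall.{s} K)
    (hV : ∃ V : MorphismProperty K,
      TwoSite.IsCofinal V J ∧ TwoSite.IsLocallySmallClass.{s} V) :
    (∃ (L : Type u) (_ : Bicategory.{max u v w, max u v} L) (Q : K ⥤ᵖ L),
      TwoSite.IsLocalisation.{wA, vA, uA} Q (TwoSite.weakEquivalences J) ∧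
        TwoSite.IsLocallyEssentiallySmall.{s} L) ∧
    ∀ (L : Type u') [Bicategory.{w', v'} L] (Q : K ⥤ᵖ L),
      TwoSite.IsLocalisation.{max u v w w', max u v v', max u u'} Q (TwoSite.weakEquivalences J) →
        TwoSite.IsLocallyEssentiallySmall.{s} L := by
  obtain ⟨V, hV, hs⟩ := hV
  have hL := TwoSite.FormalLoc.isLocallyEssentiallySmall hJ hK hV hs
  exact ⟨⟨TwoSite.FormalLoc J, inferInstance, TwoSite.FormalLoc.incl J,
    (TwoSite.isLocalisation_weakEquivalences_iff hJ _).2 TwoSite.FormalLoc.isLocalisation_incl, hL⟩,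
    fun L _ Q hQ => ((TwoSite.isLocalisation_weakEquivalences_iff hJ Q).1
      hQ).isLocallyEssentiallySmall hL⟩
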